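/- For $n\ge 1$ let $$L_n=\Big\{z\in\mathbb C^n:\ \sum_{j}|z_j|^2<1,\ \sqrt{\big(\sum_{j}|z_j|^2\big)^2-\big|\sum_{j}z_j^2\big|^2}<1-\sum_{j}|z_j|^2\Big\}$$ be the Lie ball, let $\Lambda_{n}(z_1,z_2,\dots,z_{n})=(z_1^2,z_2,\dots,z_{n})$, and put $\mathbb L_{n}=\Lambda_{n}(L_{n})$. By an automorphism of a set $S\subset\mathbb C^{m}$ we mean a bijection $S\to S$ such that it and its inverse are holomorphic, i.e. locally on $S$ restrictions of holomorphic maps on open subsets of $\mathbb C^{m}$. **Theorem.** Let $n\ge1$. The locus set $\mathcal J=\{z\in L_{n+1}:\det\Lambda_{n+1}'(z)=0\}$ equals $\{0\}\times L_n$, it satisfies $\Lambda_{n+1}(\mathcal J)=\mathcal J$, and hence $\mathcal J\subset\mathbb L_{n+1}$. Every automorphism $h$ of $\mathcal J$ extends to an automorphism of $\mathbb L_{n+1}$. More precisely, there are an automorphism $F$ of $\mathbb L_{n+1}$ with $F|_{\mathcal J}=h$ and an automorphism $a$ of $L_{n+1}$ with $a|_{\mathcal J}=h$ such that $a$ maps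 every fibre of $\Lambda_{n+1}:L_{n+1}\to\mathbb L_{n+1}$ onto a fibre, and $F\circ\Lambda_{n+1}=\Lambda_{n+1}\circ a$ on $L_{n+1}$. -/

import Mathlib

/-- The Lie ball `L_n` (classical Cartan domain of type IV) in `ℂⁿ`. -/
def lieBall (n : ℕ) : Set (EuclideanSpace ℂ (Fin n)) :=
  {z | z ∈ Metric.ball 0 1 ∧
    Real.sqrt ((∑ j, ‖z j‖ ^ 2) ^ 2 - ‖∑ j, z j ^ 2‖ ^ 2) < 1 - ∑ j, ‖z j‖ ^ 2}

/-- The polynomial map `Λ_{n+1}(z₁, z₂, …, z_{n+1}) = (z₁², z₂, …, z_{n+1})` of `ℂⁿ⁺¹`. -/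
def squareFirst (n : ℕ) (z : EuclideanSpace ℂ (Fin (n + 1))) : EuclideanSpace ℂ (Fin (n + 1)) :=
  WithLp.toLp 2 (Fin.cons (z 0 ^ 2) (fun i : Fin n => z i.succ))

/-- The domain `𝕃_{n+1} = Λ_{n+1}(L_{n+1})` in `ℂⁿ⁺¹`. -/
def lieBallImage (n : ℕ) : Set (EuclideanSpace ℂ (Fin (n + 1))) :=
  squareFirst n '' lieBall (n + 1)

/-- The inclusion `ℂⁿ → ℂⁿ⁺¹`, `z ↦ (0, z)`. -/
def consZero (n : ℕ) (z : EuclideanSpace ℂ (Fin n)) : EuclideanSpace ℂ (Fin (n + 1)) :=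
  WithLp.toLp 2 (Fin.cons 0 (fun i : Fin n => z i))

section General

variable {E : Type*} [NormedAddCommGroup E] [NormedSpace ℂ E]

/-- The locus set `𝒥_π = {z ∈ D : det π'(z) = 0}` of a map `π` on `D`. -/
def locusSet (π : E → E) (D : Set E) : Set E :=
  {z | z ∈ D ∧ (fderiv ℂ π z).det = 0}

/-- `f` is holomorphic on the set `S`: near every point of `S` it agrees on `S` with a map that is
holomorphic on an open set of the ambient space. (For open `S` this is `DifferentiableOn ℂ f S`; for
an analytic subset `S` it is the usual notion of a holomorphic map on `S`.) -/
def HolomorphicOnSet (f : E → E) (S : Set E) : Prop :=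
  ∀ p ∈ S, ∃ (U : Set E) (g : E → E),
    IsOpen U ∧ p ∈ U ∧ DifferentiableOn ℂ g U ∧ Set.EqOn f g (S ∩ U)

/-- `f` restricts to a (holomorphic) automorphism of `S`: a bijective holomorphic map `S → S` whose
inverse is holomorphic. Values of `f` outside `S` play no role. -/
def IsHolAut (f : E → E) (S : Set E) : Prop :=
  Set.MapsTo f S S ∧ HolomorphicOnSet f S ∧
    ∃ g : E → E, Set.MapsTo g S S ∧ HolomorphicOnSet g S ∧ Set.InvOn g f S S

/-- `a` preserves the fibres of `π : D → π(D)`: it maps each of them onto one of them. -/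
def PreservesFibers (a π : E → E) (D : Set E) : Prop :=
  ∀ w ∈ π '' D, ∃ w' ∈ π '' D, a '' {z | z ∈ D ∧ π z = w} = {z | z ∈ D ∧ π z = w'}

end General

/-! Write Q(z) = ∑ z_j². The locus set is a copy of L_n, so the task is to lift each automorphism f
of L_n to an automorphism a of L_{n+1} that descends through `squareFirst`. Pairs of mutually
inverse maps with such lifts (`Liftable`) are closed under composition and inversion, so it suffices
to generate the automorphisms of L_n by maps with explicit lifts.

There are two kinds of generators. A linear isometry A with Q ∘ A = c Q lifts to (z₀, z') ↦ (l z₀, A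
z') with l² = c, which descends because z₀² is multiplied by l² (`liftable_linear`). A Lorentz boost
with real parameter r lifts to the boost with parameter (0, r), whose denominator depends on z₀ only
through z₀² (`isLift_boost`).

These generate everything. A boost, a phase and a second boost carry any point of L_n to 0
(`exists_liftable_eq_zero`), which leaves automorphisms fixing 0. Schwarz estimates on the
derivative A at 0 and on its inverse force A to be unitary and Q ∘ A = c Q with |c| = 1
(`SchwarzBounds`, `liftable_of_schwarzBounds`). The equality case of the Schwarz lemma makes f agree
with A on real vectors, and the identity theorem then gives f = A on L_n (`liftable_of_map_zero`).
-/

open Metric Set Filter Topology ComplexConjugate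

/-! ### Elementary geometry of the Lie ball. -/

/-- The quadratic form `∑ z_j²`. -/
def quadSum {n : ℕ} (z : EuclideanSpace ℂ (Fin n)) : ℂ := ∑ j, z j ^ 2

theorem norm_quadSum_le {n : ℕ} (z : EuclideanSpace ℂ (Fin n)) : ‖quadSum z‖ ≤ ‖z‖ ^ 2 := by
  rw [EuclideanSpace.norm_sq_eq, quadSum]
  refine (norm_sum_le _ _).trans (le_of_eq ?_)
  simp

/-- Squaring the defining inequality cancels the fourth powers of ‖z‖. Since |Q(z)| ≤ ‖z‖², the
condition |Q(z)| < 1 can take the place of ‖z‖ < 1. This root-free form is the one used throughout.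
-/
theorem mem_lieBall_iff {n : ℕ} (z : EuclideanSpace ℂ (Fin n)) :
    z ∈ lieBall n ↔ ‖quadSum z‖ < 1 ∧ 2 * ‖z‖ ^ 2 < 1 + ‖quadSum z‖ ^ 2 := by
  have hq := norm_quadSum_le z
  have h0 := norm_nonneg (quadSum z)
  have hz := norm_nonneg z
  simp only [lieBall, mem_ofPred_eq, mem_ball_zero_iff, ← EuclideanSpace.norm_sq_eq]
  change ‖z‖ < 1 ∧ √((‖z‖ ^ 2) ^ 2 - ‖quadSum z‖ ^ 2) < _ ↔ _
  constructor
  · rintro ⟨h1, h2⟩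
    have h3 : 0 < 1 - ‖z‖ ^ 2 := by nlinarith
    rw [Real.sqrt_lt' h3] at h2
    constructor <;> nlinarith
  · rintro ⟨h1, h2⟩
    have h3 : ‖z‖ < 1 := by nlinarith
    have h4 : 0 < 1 - ‖z‖ ^ 2 := by nlinarith
    refine ⟨h3, ?_⟩
    rw [Real.sqrt_lt' h4]
    nlinarith

theorem norm_lt_one_of_mem_lieBall {n : ℕ} {z : EuclideanSpace ℂ (Fin n)} (hz : z ∈ lieBall n) :
    ‖z‖ < 1 := by
  simpa using hz.1

theorem zero_mem_lieBall (n : ℕ) : (0 : EuclideanSpace ℂ (Fin n)) ∈ lieBall n := by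
  rw [mem_lieBall_iff]; simp [quadSum]

theorem quadSum_smul {n : ℕ} (c : ℂ) (z : EuclideanSpace ℂ (Fin n)) :
    quadSum (c • z) = c ^ 2 * quadSum z := by
  simp [quadSum, mul_pow, Finset.mul_sum]

theorem smul_mem_lieBall {n : ℕ} {c : ℂ} (hc : ‖c‖ ≤ 1) {z : EuclideanSpace ℂ (Fin n)}
    (hz : z ∈ lieBall n) : c • z ∈ lieBall n := by
  rw [mem_lieBall_iff] at hz ⊢
  rw [quadSum_smul, norm_smul, norm_mul, norm_pow]
  obtain ⟨h1, h2⟩ := hz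
  have h0 := norm_nonneg (quadSum z)
  have h3 : ‖c‖ ^ 2 ≤ 1 := pow_le_one₀ (norm_nonneg _) hc
  have h4 : 0 ≤ ‖c‖ ^ 2 := by positivity
  have h5 : ‖quadSum z‖ ^ 2 < 1 := by nlinarith
  rw [mul_pow, mul_pow]
  generalize ‖c‖ ^ 2 = t at h3 h4 ⊢
  refine ⟨by nlinarith, ?_⟩
  rcases h3.eq_or_lt with rfl | h6
  · linarith
  -- With q = |Q(z)|, the remaining gap is t(1 + q²) < 1 + t²q², that is, (1 - t)(1 - tq²) > 0.
  · nlinarith [mul_nonneg h4 (sub_nonneg.2 h2.le),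
      mul_pos (sub_pos.2 h6) (show 0 < 1 - t * ‖quadSum z‖ ^ 2 by nlinarith)]

theorem differentiable_quadSum (n : ℕ) :
    Differentiable ℂ (quadSum : EuclideanSpace ℂ (Fin n) → ℂ) := by
  unfold quadSum; fun_prop

theorem isOpen_lieBall (n : ℕ) : IsOpen (lieBall n) := by
  have h : lieBall n = {z | ‖quadSum z‖ < 1} ∩ {z | 2 * ‖z‖ ^ 2 < 1 + ‖quadSum z‖ ^ 2} := by
    ext z; exact mem_lieBall_iff z
  have hc := (differentiable_quadSum n).continuous
  rw [h]
  exact (isOpen_lt (by fun_prop) (by fun_prop)).inter (isOpen_lt (by fun_prop) (by fun_prop))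

theorem ball_subset_lieBall (n : ℕ) : ball 0 (1 / 2) ⊆ lieBall n := by
  intro z hz
  rw [mem_ball_zero_iff] at hz
  rw [mem_lieBall_iff]
  have := norm_quadSum_le z
  have := norm_nonneg z
  constructor <;> nlinarith [sq_nonneg ‖quadSum z‖]

/-! ### Splitting off the first coordinate, and the locus set. -/

/-- The remaining coordinates of a point of `ℂⁿ⁺¹`. -/
def dropFirst {n : ℕ} (z : EuclideanSpace ℂ (Fin (n + 1))) : EuclideanSpace ℂ (Fin n) :=
  WithLp.toLp 2 fun i => z i.succ

@[simp] theorem dropFirst_apply {n : ℕ} (z : EuclideanSpace ℂ (Fin (n + 1))) (i : Fin n) :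
    dropFirst z i = z i.succ := rfl

@[simp] theorem consZero_zero {n : ℕ} (z : EuclideanSpace ℂ (Fin n)) : consZero n z 0 = 0 := rfl

@[simp] theorem consZero_succ {n : ℕ} (z : EuclideanSpace ℂ (Fin n)) (i : Fin n) :
    consZero n z i.succ = z i := rfl

@[simp] theorem squareFirst_zero {n : ℕ} (z : EuclideanSpace ℂ (Fin (n + 1))) :
    squareFirst n z 0 = z 0 ^ 2 := rfl

@[simp] theorem squareFirst_succ {n : ℕ} (z : EuclideanSpace ℂ (Fin (n + 1))) (i : Fin n) :
    squareFirst n z i.succ = z i.succ := rfl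

@[simp] theorem dropFirst_consZero {n : ℕ} (z : EuclideanSpace ℂ (Fin n)) :
    dropFirst (consZero n z) = z := rfl

theorem ext_succ {n : ℕ} {z w : EuclideanSpace ℂ (Fin (n + 1))} (h0 : z 0 = w 0)
    (h : ∀ i : Fin n, z i.succ = w i.succ) : z = w := by
  ext i
  exact Fin.cases h0 h i

theorem consZero_dropFirst {n : ℕ} {z : EuclideanSpace ℂ (Fin (n + 1))} (h : z 0 = 0) :
    consZero n (dropFirst z) = z :=
  ext_succ (by simp [h]) (by simp)

theorem squareFirst_consZero {n : ℕ} (z : EuclideanSpace ℂ (Fin n)) :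
    squareFirst n (consZero n z) = consZero n z :=
  ext_succ (by simp) (by simp)

theorem quadSum_succ {n : ℕ} (z : EuclideanSpace ℂ (Fin (n + 1))) :
    quadSum z = z 0 ^ 2 + quadSum (dropFirst z) := by
  simp [quadSum, Fin.sum_univ_succ]

theorem norm_sq_succ {n : ℕ} (z : EuclideanSpace ℂ (Fin (n + 1))) :
    ‖z‖ ^ 2 = ‖z 0‖ ^ 2 + ‖dropFirst z‖ ^ 2 := by
  simp [EuclideanSpace.norm_sq_eq, Fin.sum_univ_succ]

theorem consZero_mem_lieBall {n : ℕ} {z : EuclideanSpace ℂ (Fin n)} :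
    consZero n z ∈ lieBall (n + 1) ↔ z ∈ lieBall n := by
  simp [mem_lieBall_iff, quadSum_succ, norm_sq_succ]

theorem differentiable_consZero (n : ℕ) : Differentiable ℂ (consZero n) := by
  rw [differentiable_euclidean]
  intro i
  refine Fin.cases ?_ (fun i => ?_) i
  · simp
  · simp only [consZero_succ]; fun_prop

theorem differentiable_dropFirst (n : ℕ) :
    Differentiable ℂ (dropFirst : EuclideanSpace ℂ (Fin (n + 1)) → _) := by
  rw [differentiable_euclidean]
  intro i
  simp only [dropFirst_apply]; fun_prop

theorem differentiable_squareFirst (n : ℕ) : Differentiable ℂ (squareFirst n) := by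
  rw [differentiable_euclidean]
  intro i
  refine Fin.cases ?_ (fun i => ?_) i
  · simp only [squareFirst_zero]; fun_prop
  · simp only [squareFirst_succ]; fun_prop

theorem fderiv_squareFirst_zero {n : ℕ} (z v : EuclideanSpace ℂ (Fin (n + 1))) :
    fderiv ℂ (squareFirst n) z v 0 = 2 * z 0 * v 0 := by
  have h : HasFDerivAt (squareFirst n) (fderiv ℂ (squareFirst n) z) z :=
    (differentiable_squareFirst n z).hasFDerivAt
  have h1 := (EuclideanSpace.proj (𝕜 := ℂ) (0 : Fin (n + 1))).hasFDerivAt.comp z h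
  have h2 := ((EuclideanSpace.proj (𝕜 := ℂ) (0 : Fin (n + 1))).hasFDerivAt (x := z)).pow 2
  simpa using DFunLike.congr_fun (h1.unique h2) v

theorem fderiv_squareFirst_succ {n : ℕ} (z v : EuclideanSpace ℂ (Fin (n + 1))) (i : Fin n) :
    fderiv ℂ (squareFirst n) z v i.succ = v i.succ := by
  have h : HasFDerivAt (squareFirst n) (fderiv ℂ (squareFirst n) z) z :=
    (differentiable_squareFirst n z).hasFDerivAt
  have h1 := (EuclideanSpace.proj (𝕜 := ℂ) i.succ).hasFDerivAt.comp z h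
  have h2 := ((EuclideanSpace.proj (𝕜 := ℂ) i.succ).hasFDerivAt (x := z))
  exact DFunLike.congr_fun (h1.unique h2) v

theorem det_fderiv_squareFirst_eq_zero_iff {n : ℕ} (z : EuclideanSpace ℂ (Fin (n + 1))) :
    (fderiv ℂ (squareFirst n) z).det = 0 ↔ z 0 = 0 := by
  rw [ContinuousLinearMap.det, LinearMap.det_eq_zero_iff_ker_ne_bot, Submodule.ne_bot_iff]
  constructor
  · rintro ⟨v, hv, hv0⟩
    by_contra hz
    refine hv0 (ext_succ ?_ fun i => ?_)
    · have := fderiv_squareFirst_zero z v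
      rw [LinearMap.mem_ker, ContinuousLinearMap.coe_coe] at hv
      rw [hv] at this
      simpa [hz] using this.symm
    · have := fderiv_squareFirst_succ z v i
      rw [LinearMap.mem_ker, ContinuousLinearMap.coe_coe] at hv
      rw [hv] at this
      simpa using this.symm
  · intro hz
    refine ⟨EuclideanSpace.single 0 1, ?_, by simp⟩
    rw [LinearMap.mem_ker, ContinuousLinearMap.coe_coe]
    refine ext_succ ?_ fun i => ?_
    · rw [fderiv_squareFirst_zero]; simp [hz]
    · rw [fderiv_squareFirst_succ]; simp

theorem locusSet_squareFirst (n : ℕ) :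
    locusSet (squareFirst n) (lieBall (n + 1)) = consZero n '' lieBall n := by
  ext z
  simp only [locusSet, mem_ofPred_eq, det_fderiv_squareFirst_eq_zero_iff, mem_image]
  constructor
  · rintro ⟨hz, h0⟩
    have h := consZero_dropFirst h0
    exact ⟨dropFirst z, consZero_mem_lieBall.1 (h ▸ hz), h⟩
  · rintro ⟨w, hw, rfl⟩
    exact ⟨consZero_mem_lieBall.2 hw, rfl⟩

/-! ### Holomorphic maps on arbitrary sets. -/

section Holomorphic

variable {E : Type*} [NormedAddCommGroup E] [NormedSpace ℂ E]

theorem DifferentiableOn.holomorphicOnSet {f : E → E} {S : Set E} (hS : IsOpen S)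
    (hf : DifferentiableOn ℂ f S) : HolomorphicOnSet f S :=
  fun _ hp => ⟨S, f, hS, hp, hf, fun _ _ => rfl⟩

/-- Serves for maps of `lieBallImage`, whose openness is then never needed. -/
theorem holomorphicOnSet_of_subset_isOpen {f : E → E} {S : Set E}
    (hf : ∃ U, IsOpen U ∧ S ⊆ U ∧ DifferentiableOn ℂ f U) : HolomorphicOnSet f S := by
  obtain ⟨U, hU, hSU, hfU⟩ := hf
  exact fun p hp => ⟨U, f, hU, hSU hp, hfU, fun _ _ => rfl⟩

theorem HolomorphicOnSet.comp {f g : E → E} {S T : Set E} (hg : HolomorphicOnSet g T)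
    (hf : HolomorphicOnSet f S) (h : MapsTo f S T) : HolomorphicOnSet (g ∘ f) S := by
  intro p hp
  obtain ⟨U, F, hU, hpU, hF, hfF⟩ := hf p hp
  obtain ⟨V, G, hV, hpV, hG, hgG⟩ := hg (f p) (h hp)
  refine ⟨U ∩ F ⁻¹' V, G ∘ F, hF.continuousOn.isOpen_inter_preimage hU hV,
    ⟨hpU, by rwa [mem_preimage, ← hfF ⟨hp, hpU⟩]⟩, hG.comp (hF.mono inter_subset_left)
    fun x hx => hx.2, ?_⟩
  rintro x ⟨hxS, hxU, hxV⟩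
  have h1 := hfF ⟨hxS, hxU⟩
  rw [mem_preimage, ← h1] at hxV
  simp only [Function.comp_apply, ← h1]
  exact hgG ⟨h hxS, hxV⟩

end Holomorphic

/-! ### Calculus of liftable automorphisms, and the linear ones. -/

/-- `f` lifts to holomorphic self-maps `a` of `L_{n+1}` and `F` of `𝕃_{n+1}`. -/
structure IsLift (n : ℕ) (f : EuclideanSpace ℂ (Fin n) → EuclideanSpace ℂ (Fin n))
    (a F : EuclideanSpace ℂ (Fin (n + 1)) → EuclideanSpace ℂ (Fin (n + 1))) : Prop where
  mapsTo : MapsTo a (lieBall (n + 1)) (lieBall (n + 1))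
  holomorphic : HolomorphicOnSet a (lieBall (n + 1))
  holomorphic_image : HolomorphicOnSet F (lieBallImage n)
  semiconj : ∀ z ∈ lieBall (n + 1), F (squareFirst n z) = squareFirst n (a z)
  restrict : ∀ z ∈ lieBall n, a (consZero n z) = consZero n (f z)

section Lift

variable {n : ℕ} {f f' g g' : EuclideanSpace ℂ (Fin n) → EuclideanSpace ℂ (Fin n)}
  {a a' b b' F F' G : EuclideanSpace ℂ (Fin (n + 1)) → EuclideanSpace ℂ (Fin (n + 1))}

namespace IsLift

theorem mapsTo_image (h : IsLift n f a F) : MapsTo F (lieBallImage n) (lieBallImage n) := by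
  rintro _ ⟨z, hz, rfl⟩
  exact ⟨a z, h.mapsTo hz, (h.semiconj z hz).symm⟩

theorem mapsTo_restrict (h : IsLift n f a F) : MapsTo f (lieBall n) (lieBall n) := by
  intro z hz
  rw [← consZero_mem_lieBall, ← h.restrict z hz]
  exact h.mapsTo (consZero_mem_lieBall.2 hz)

theorem differentiableOn (h : IsLift n f a F) : DifferentiableOn ℂ f (lieBall n) := by
  intro z hz
  obtain ⟨U, A, hU, hzU, hA, haA⟩ := h.holomorphic _ (consZero_mem_lieBall.2 hz)
  have h1 : DifferentiableAt ℂ (dropFirst ∘ A ∘ consZero n) z :=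
    (differentiable_dropFirst n _).comp z
      (((hA _ hzU).differentiableAt (hU.mem_nhds hzU)).comp z (differentiable_consZero n z))
  refine (h1.congr_of_eventuallyEq ?_).differentiableWithinAt
  filter_upwards [(isOpen_lieBall n).mem_nhds hz,
    (differentiable_consZero n).continuous.continuousAt.preimage_mem_nhds (hU.mem_nhds hzU)]
    with w hw hwU
  simp only [Function.comp_apply]
  rw [← haA ⟨consZero_mem_lieBall.2 hw, hwU⟩, h.restrict w hw, dropFirst_consZero]

theorem comp (hg : IsLift n g b G) (hf : IsLift n f a F) : IsLift n (g ∘ f) (b ∘ a) (G ∘ F) where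
  mapsTo := hg.mapsTo.comp hf.mapsTo
  holomorphic := hg.holomorphic.comp hf.holomorphic hf.mapsTo
  holomorphic_image := hg.holomorphic_image.comp hf.holomorphic_image hf.mapsTo_image
  semiconj z hz := by
    simp only [Function.comp_apply]
    rw [hf.semiconj z hz, hg.semiconj _ (hf.mapsTo hz)]
  restrict z hz := by
    simp only [Function.comp_apply]
    rw [hf.restrict z hz, hg.restrict _ (hf.mapsTo_restrict hz)]

theorem congr (hf : IsLift n f a F) (h : EqOn g f (lieBall n)) : IsLift n g a F :=
  { hf with restrict := fun z hz => by rw [hf.restrict z hz, h hz] }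

end IsLift

/-- `f` and `f'` are mutually inverse automorphisms of `L_n` that lift to automorphisms of
`L_{n+1}` and `𝕃_{n+1}` which are intertwined by `Λ_{n+1}`. -/
def Liftable (n : ℕ) (f f' : EuclideanSpace ℂ (Fin n) → EuclideanSpace ℂ (Fin n)) : Prop :=
  ∃ a F a' F', IsLift n f a F ∧ IsLift n f' a' F' ∧ InvOn a' a (lieBall (n + 1)) (lieBall (n + 1))

namespace Liftable

theorem symm (h : Liftable n f f') : Liftable n f' f := by
  obtain ⟨a, F, a', F', h1, h2, h3⟩ := h
  exact ⟨a', F', a, F, h2, h1, h3.symm⟩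

theorem comp (hg : Liftable n g g') (hf : Liftable n f f') : Liftable n (g ∘ f) (f' ∘ g') := by
  obtain ⟨a, F, a', F', h1, h2, h3⟩ := hf
  obtain ⟨b, G, b', G', k1, k2, k3⟩ := hg
  exact ⟨b ∘ a, G ∘ F, a' ∘ b', F' ∘ G', k1.comp h1, h2.comp k2, h3.comp k3 h1.mapsTo k2.mapsTo⟩

theorem congr (hf : Liftable n f f') (h : EqOn g f (lieBall n)) (h' : EqOn g' f' (lieBall n)) :
    Liftable n g g' := by
  obtain ⟨a, F, a', F', h1, h2, h3⟩ := hf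
  exact ⟨a, F, a', F', h1.congr h, h2.congr h', h3⟩

theorem mapsTo (h : Liftable n f f') : MapsTo f (lieBall n) (lieBall n) := by
  obtain ⟨a, F, a', F', h1, -⟩ := h
  exact h1.mapsTo_restrict

theorem differentiableOn (h : Liftable n f f') : DifferentiableOn ℂ f (lieBall n) := by
  obtain ⟨a, F, a', F', h1, -⟩ := h
  exact h1.differentiableOn

theorem leftInvOn (h : Liftable n f f') : LeftInvOn f' f (lieBall n) := by
  obtain ⟨a, F, a', F', h1, h2, h3⟩ := h
  intro z hz
  have h4 := h3.1 (consZero_mem_lieBall.2 hz)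
  rw [h1.restrict z hz, h2.restrict _ (h1.mapsTo_restrict hz)] at h4
  exact congrArg dropFirst h4

theorem exists_automorphisms (h : Liftable n f f') :
    ∃ F a : EuclideanSpace ℂ (Fin (n + 1)) → EuclideanSpace ℂ (Fin (n + 1)),
      IsHolAut F (lieBallImage n) ∧ IsHolAut a (lieBall (n + 1)) ∧
      (∀ z ∈ lieBall n, F (consZero n z) = consZero n (f z)) ∧
      (∀ z ∈ lieBall n, a (consZero n z) = consZero n (f z)) ∧
      PreservesFibers a (squareFirst n) (lieBall (n + 1)) ∧
      ∀ z ∈ lieBall (n + 1), F (squareFirst n z) = squareFirst n (a z) := by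
  obtain ⟨a, F, a', F', h1, h2, h3⟩ := h
  have hF : LeftInvOn F' F (lieBallImage n) := by
    rintro _ ⟨z, hz, rfl⟩
    rw [h1.semiconj z hz, h2.semiconj _ (h1.mapsTo hz), h3.1 hz]
  have hF' : LeftInvOn F F' (lieBallImage n) := by
    rintro _ ⟨z, hz, rfl⟩
    rw [h2.semiconj z hz, h1.semiconj _ (h2.mapsTo hz), h3.2 hz]
  refine ⟨F, a, ⟨h1.mapsTo_image, h1.holomorphic_image, F', h2.mapsTo_image,
    h2.holomorphic_image, hF, hF'⟩, ⟨h1.mapsTo, h1.holomorphic, a', h2.mapsTo, h2.holomorphic, h3⟩,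
    fun z hz => ?_, h1.restrict, ?_, h1.semiconj⟩
  · have h4 := h1.semiconj _ (consZero_mem_lieBall.2 hz)
    rwa [squareFirst_consZero, h1.restrict z hz, squareFirst_consZero] at h4
  · intro w hw
    refine ⟨F w, h1.mapsTo_image hw, Subset.antisymm ?_ ?_⟩
    · rintro _ ⟨z, ⟨hz, rfl⟩, rfl⟩
      exact ⟨h1.mapsTo hz, (h1.semiconj z hz).symm⟩
    -- The preimage a'(z) lies in the right fibre because F is injective on 𝕃_{n+1} and takes the
    -- same value at Λ(a'(z)) and at w.
    · rintro z ⟨hz, hzw⟩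
      refine ⟨a' z, ⟨h2.mapsTo hz, hF.injOn (mem_image_of_mem _ (h2.mapsTo hz)) hw ?_⟩, h3.2 hz⟩
      rw [h1.semiconj _ (h2.mapsTo hz), h3.2 hz, hzw]

end Liftable

/-- An invertible linear map that preserves the norm and multiplies the quadratic form by a
constant is liftable. -/
theorem liftable_linear {A A' : EuclideanSpace ℂ (Fin n) →L[ℂ] EuclideanSpace ℂ (Fin n)} {c : ℂ}
    (hc : ‖c‖ = 1) (hA : ∀ z, ‖A z‖ = ‖z‖) (hQ : ∀ z, quadSum (A z) = c * quadSum z)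
    (hl : ∀ z, A' (A z) = z) (hr : ∀ z, A (A' z) = z) : Liftable n A A' := by
  have key : ∀ (B : EuclideanSpace ℂ (Fin n) →L[ℂ] EuclideanSpace ℂ (Fin n)) (l : ℂ),
      ‖l‖ = 1 → (∀ z, ‖B z‖ = ‖z‖) → (∀ z, quadSum (B z) = l ^ 2 * quadSum z) →
      IsLift n B (fun z => WithLp.toLp 2 (Fin.cons (l * z 0) fun i => B (dropFirst z) i))
        (fun z => WithLp.toLp 2 (Fin.cons (l ^ 2 * z 0) fun i => B (dropFirst z) i)) := by
    intro B l hl hB hQB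
    have hd : ∀ m : ℂ, Differentiable ℂ fun z : EuclideanSpace ℂ (Fin (n + 1)) =>
        (WithLp.toLp 2 (Fin.cons (m * z 0) fun i => B (dropFirst z) i) :
          EuclideanSpace ℂ (Fin (n + 1))) := by
      intro m
      rw [differentiable_euclidean]
      intro i
      have := B.differentiable.comp (differentiable_dropFirst n)
      rw [differentiable_euclidean] at this
      refine Fin.cases ?_ (fun i => ?_) i
      · simp only [Fin.cons_zero]; fun_prop
      · exact this i
    refine ⟨?_, ?_, ?_, ?_, ?_⟩
    · intro z hz
      rw [mem_lieBall_iff] at hz ⊢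
      have h1 : dropFirst (WithLp.toLp 2 (Fin.cons (l * z 0) fun i => B (dropFirst z) i) :
          EuclideanSpace ℂ (Fin (n + 1))) = B (dropFirst z) := by ext; simp
      rw [quadSum_succ, norm_sq_succ, h1, hB, hQB]
      rw [quadSum_succ, norm_sq_succ] at hz
      have h2 : (l * z 0) ^ 2 + l ^ 2 * quadSum (dropFirst z)
        = l ^ 2 * (z 0 ^ 2 + quadSum (dropFirst z)) := by ring
      simp only [Fin.cons_zero, h2, norm_mul, norm_pow, hl, one_pow, one_mul]
      simpa using hz
    · exact (hd l).differentiableOn.holomorphicOnSet (isOpen_lieBall _)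
    · exact holomorphicOnSet_of_subset_isOpen
        ⟨univ, isOpen_univ, subset_univ _, (hd _).differentiableOn⟩
    · intro z _
      refine ext_succ ?_ fun i => ?_
      · simp [mul_pow]
      · simp; rfl
    · intro z _
      refine ext_succ ?_ fun i => ?_
      · simp
      · simp
  -- The first coordinate must be scaled by a square root of c, so that the quadratic form of ℂⁿ⁺¹
  -- is multiplied by c as a whole.
  obtain ⟨l, hl2⟩ := IsSquare.exists_sq c (IsAlgClosed.exists_pow_nat_eq c two_pos |>.elim
    fun z hz => ⟨z, by rw [← hz, sq]⟩)
  have hln : ‖l‖ = 1 := by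
    have : ‖l‖ ^ 2 = 1 := by rw [← norm_pow, ← hl2, hc]
    exact (pow_eq_one_iff_of_nonneg (norm_nonneg _) two_ne_zero).1 this
  have hl0 : l ≠ 0 := by rintro rfl; simp at hln
  refine ⟨_, _, _, _, key A l hln hA (by simpa [← hl2] using hQ), key A' l⁻¹ (by simp [hln])
    (fun z => by rw [← hA, hr]) (fun z => ?_), ?_, ?_⟩
  · have := hQ (A' z)
    rw [hr, hl2] at this
    rw [this]; field_simp
  · intro z _
    refine ext_succ ?_ fun i => ?_
    · simp [hl0]
    · exact congrFun (congrArg WithLp.ofLp (hl (dropFirst z))) i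
  · intro z _
    refine ext_succ ?_ fun i => ?_
    · simp [hl0]
    · exact congrFun (congrArg WithLp.ofLp (hr (dropFirst z))) i

end Lift

/-! ### Lorentz boosts of the Lie ball. -/

section Boost

variable {n : ℕ}

/-- The complex bilinear pairing of a real vector with a complex one. -/
def realPair (r : Fin n → ℝ) (z : EuclideanSpace ℂ (Fin n)) : ℂ := ∑ j, (r j : ℂ) * z j

/-- The squared length of a real vector. -/
def sqLen (r : Fin n → ℝ) : ℝ := ∑ j, r j ^ 2

theorem sqLen_nonneg (r : Fin n → ℝ) : 0 ≤ sqLen r := Finset.sum_nonneg fun _ _ => sq_nonneg _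

@[simp] theorem sqLen_neg (r : Fin n → ℝ) : sqLen (-r) = sqLen r := by simp [sqLen]

theorem realPair_neg (r : Fin n → ℝ) (z : EuclideanSpace ℂ (Fin n)) :
    realPair (-r) z = -realPair r z := by simp [realPair]

theorem differentiable_realPair (r : Fin n → ℝ) : Differentiable ℂ (realPair r) := by
  unfold realPair; fun_prop

/-- The denominator of the boost. -/
def boostDen (r : Fin n → ℝ) (z : EuclideanSpace ℂ (Fin n)) : ℂ :=
  1 + sqLen r * quadSum z - 2 * realPair r z

/-- The numerator of the quadratic form of the boost. -/
def boostNum (r : Fin n → ℝ) (z : EuclideanSpace ℂ (Fin n)) : ℂ :=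
  sqLen r + quadSum z - 2 * realPair r z

/-- The vector numerator of the boost. -/
def boostVec (r : Fin n → ℝ) (z : EuclideanSpace ℂ (Fin n)) : EuclideanSpace ℂ (Fin n) :=
  WithLp.toLp 2 fun j => (1 - sqLen r) * z j + (2 * realPair r z - 1 - quadSum z) * r j

/-- The automorphism of the Lie ball given by the Lorentz boost that takes the real point `r`
to `0`. -/
noncomputable def boost (r : Fin n → ℝ) (z : EuclideanSpace ℂ (Fin n)) : EuclideanSpace ℂ (Fin n) :=
  (boostDen r z)⁻¹ • boostVec r z

theorem boost_apply (r : Fin n → ℝ) (z : EuclideanSpace ℂ (Fin n)) (j : Fin n) :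
    boost r z j = (boostDen r z)⁻¹ *
      ((1 - sqLen r) * z j + (2 * realPair r z - 1 - quadSum z) * r j) := rfl

theorem realPair_smul (r : Fin n → ℝ) (c : ℂ) (z : EuclideanSpace ℂ (Fin n)) :
    realPair r (c • z) = c * realPair r z := by
  simp only [realPair, PiLp.smul_apply, smul_eq_mul, Finset.mul_sum]
  exact Finset.sum_congr rfl fun _ _ => by ring

theorem realPair_boostVec (r : Fin n → ℝ) (z : EuclideanSpace ℂ (Fin n)) :
    realPair r (boostVec r z) = (1 - sqLen r) * realPair r z +
      (2 * realPair r z - 1 - quadSum z) * sqLen r := by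
  have h : (sqLen r : ℂ) = ∑ j, (r j : ℂ) ^ 2 := by simp [sqLen]
  calc realPair r (boostVec r z) = (1 - sqLen r) * realPair r z +
      (2 * realPair r z - 1 - quadSum z) * ∑ j, (r j : ℂ) ^ 2 := by
        conv_lhs => rw [realPair]
        conv_rhs => enter [1, 2]; rw [realPair]
        rw [Finset.mul_sum, Finset.mul_sum, ← Finset.sum_add_distrib]
        exact Finset.sum_congr rfl fun _ _ => by simp only [boostVec]; ring
    _ = _ := by rw [← h]

/-- Since one factor is the denominator itself, Q(boost) is the quotient `boostNum` / `boostDen`.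
Hence a boost acts linearly, up to a common factor, on the homogeneous coordinates (z, 1 + Q, 1 -
Q): it mixes z with 1 + Q and only rescales 1 - Q. -/
theorem quadSum_boostVec (r : Fin n → ℝ) (z : EuclideanSpace ℂ (Fin n)) :
    quadSum (boostVec r z) = boostDen r z * boostNum r z := by
  have h : (sqLen r : ℂ) = ∑ j, (r j : ℂ) ^ 2 := by simp [sqLen]
  have h1 : quadSum (boostVec r z) = (1 - sqLen r) ^ 2 * quadSum z +
      2 * (1 - sqLen r) * (2 * realPair r z - 1 - quadSum z) * realPair r z +
      (2 * realPair r z - 1 - quadSum z) ^ 2 * ∑ j, (r j : ℂ) ^ 2 := by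
    conv_lhs => rw [quadSum]
    conv_rhs => enter [1, 1, 2]; rw [quadSum]
    conv_rhs => enter [1, 2, 2]; rw [realPair]
    rw [Finset.mul_sum, Finset.mul_sum, Finset.mul_sum, ← Finset.sum_add_distrib,
      ← Finset.sum_add_distrib]
    exact Finset.sum_congr rfl fun _ _ => by simp only [boostVec]; ring
  rw [h1, ← h, boostDen, boostNum]
  ring

theorem norm_sq_boostVec (r : Fin n → ℝ) (z : EuclideanSpace ℂ (Fin n)) :
    ‖boostVec r z‖ ^ 2 = (1 - sqLen r) ^ 2 * ‖z‖ ^ 2 +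
      2 * (1 - sqLen r) * (conj (2 * realPair r z - 1 - quadSum z) * realPair r z).re +
      ‖2 * realPair r z - 1 - quadSum z‖ ^ 2 * sqLen r := by
  set c := 2 * realPair r z - 1 - quadSum z with hc
  have h2 : (conj c * realPair r z).re = ∑ j, (conj c * (r j * z j)).re := by
    rw [realPair, Finset.mul_sum, Complex.re_sum]
  rw [h2, sqLen, EuclideanSpace.norm_sq_eq, EuclideanSpace.norm_sq_eq, Finset.mul_sum,
    Finset.mul_sum, Finset.mul_sum, ← Finset.sum_add_distrib, ← Finset.sum_add_distrib]
  refine Finset.sum_congr rfl fun j _ => ?_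
  simp only [boostVec, ← hc]
  rw [← sqLen, Complex.sq_norm, Complex.sq_norm, Complex.sq_norm, Complex.normSq_apply,
    Complex.normSq_apply, Complex.normSq_apply]
  simp
  ring

/-- The real part of `z` rotated by the phase of `1 - Q(z)`. -/
def rotRe (z : EuclideanSpace ℂ (Fin n)) (j : Fin n) : ℝ := (conj (1 - quadSum z) * z j).re

/-- In a point of the Lie ball, `rotRe` is a vector of length less than
`(1 - |Q(z)|²) / 2`. -/
theorem four_mul_sqLen_rotRe_lt {z : EuclideanSpace ℂ (Fin n)} (hz : z ∈ lieBall n) :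
    4 * sqLen (rotRe z) < (1 - ‖quadSum z‖ ^ 2) ^ 2 := by
  rw [mem_lieBall_iff] at hz
  set D := 1 - quadSum z with hD
  have h1 : sqLen (rotRe z) = (‖D‖ ^ 2 * ‖z‖ ^ 2 + (conj D ^ 2 * quadSum z).re) / 2 := by
    rw [quadSum, Finset.mul_sum, Complex.re_sum, EuclideanSpace.norm_sq_eq, Finset.mul_sum,
      ← Finset.sum_add_distrib, Finset.sum_div, sqLen]
    refine Finset.sum_congr rfl fun j _ => ?_
    simp only [rotRe, ← hD]
    rw [Complex.sq_norm, Complex.sq_norm, Complex.normSq_apply, Complex.normSq_apply]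
    simp only [pow_two]
    simp
    ring
  have hD0 : 0 < ‖D‖ ^ 2 := by
    have : D ≠ 0 := by
      intro h
      rw [sub_eq_zero] at h
      rw [← h] at hz
      simp at hz
    positivity
  have h2 : (1 - ‖quadSum z‖ ^ 2) ^ 2 - 4 * sqLen (rotRe z) =
      ‖D‖ ^ 2 * (1 + ‖quadSum z‖ ^ 2 - 2 * ‖z‖ ^ 2) := by
    rw [h1, hD, Complex.sq_norm (1 - quadSum z), Complex.sq_norm (quadSum z), Complex.normSq_apply,
      Complex.normSq_apply]
    simp only [pow_two]
    simp
    ring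
  nlinarith [mul_pos hD0 (sub_pos.2 hz.2)]

theorem normSq_boostDen_sub (r : Fin n → ℝ) (z : EuclideanSpace ℂ (Fin n)) :
    ‖boostDen r z‖ ^ 2 - ‖boostNum r z‖ ^ 2 =
      (1 - sqLen r) * ((1 + sqLen r) * (1 - ‖quadSum z‖ ^ 2) - 4 * ∑ j, r j * rotRe z j) := by
  have h : ∑ j, r j * rotRe z j = (conj (1 - quadSum z) * realPair r z).re := by
    rw [realPair, Finset.mul_sum, Complex.re_sum]
    refine Finset.sum_congr rfl fun j _ => ?_
    simp only [rotRe]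
    simp
    ring
  rw [h, boostDen, boostNum, Complex.sq_norm, Complex.sq_norm, Complex.sq_norm,
    Complex.normSq_apply, Complex.normSq_apply, Complex.normSq_apply]
  simp
  ring

/-- This is |Q(boost)| < 1. By `normSq_boostDen_sub` it reduces to 4 r·v < (1 + |r|²)(1 - |Q|²) with
v = `rotRe z`, which follows from Cauchy–Schwarz, the bound 2|v| < 1 - |Q|² and 2|r| ≤ 1 + |r|². -/
theorem norm_boostNum_lt {r : Fin n → ℝ} (hr : sqLen r < 1) {z : EuclideanSpace ℂ (Fin n)}
    (hz : z ∈ lieBall n) : ‖boostNum r z‖ < ‖boostDen r z‖ := by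
  have h1 := normSq_boostDen_sub r z
  have h2 := four_mul_sqLen_rotRe_lt hz
  have h3 : (∑ j, r j * rotRe z j) ^ 2 ≤ sqLen r * sqLen (rotRe z) :=
    Finset.sum_mul_sq_le_sq_mul_sq _ _ _
  rw [mem_lieBall_iff] at hz
  have h4 : 0 < 1 - ‖quadSum z‖ ^ 2 := by nlinarith [norm_nonneg (quadSum z)]
  have h5 : 4 * ∑ j, r j * rotRe z j < (1 + sqLen r) * (1 - ‖quadSum z‖ ^ 2) := by
    have h0 := sqLen_nonneg r
    refine lt_of_pow_lt_pow_left₀ 2 (by positivity) ?_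
    calc (4 * ∑ j, r j * rotRe z j) ^ 2 ≤ 4 * sqLen r * (4 * sqLen (rotRe z)) := by linarith
      _ ≤ 4 * sqLen r * (1 - ‖quadSum z‖ ^ 2) ^ 2 := by gcongr
      _ < ((1 + sqLen r) * (1 - ‖quadSum z‖ ^ 2)) ^ 2 := by
        rw [mul_pow]
        have : 0 < (1 - sqLen r) ^ 2 := pow_pos (sub_pos.2 hr) 2
        exact mul_lt_mul_of_pos_right (by nlinarith) (by positivity)
  refine lt_of_pow_lt_pow_left₀ 2 (norm_nonneg _) ?_
  have := mul_pos (sub_pos.2 hr) (sub_pos.2 h5)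
  linarith

theorem boostDen_ne_zero {r : Fin n → ℝ} (hr : sqLen r < 1) {z : EuclideanSpace ℂ (Fin n)}
    (hz : z ∈ lieBall n) : boostDen r z ≠ 0 :=
  norm_pos_iff.1 ((norm_nonneg _).trans_lt (norm_boostNum_lt hr hz))

theorem boost_mem_lieBall {r : Fin n → ℝ} (hr : sqLen r < 1) {z : EuclideanSpace ℂ (Fin n)}
    (hz : z ∈ lieBall n) : boost r z ∈ lieBall n := by
  have h0 := boostDen_ne_zero hr hz
  have h1 := norm_boostNum_lt hr hz
  have h2 : 0 < ‖boostDen r z‖ := norm_pos_iff.2 h0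
  have hQ : quadSum (boost r z) = boostNum r z / boostDen r z := by
    rw [boost, quadSum_smul, quadSum_boostVec]; field_simp
  rw [mem_lieBall_iff] at hz ⊢
  rw [hQ, boost, norm_smul, mul_pow, norm_div, norm_inv, norm_sq_boostVec]
  refine ⟨(div_lt_one h2).2 h1, ?_⟩
  rw [inv_pow, div_pow, ← sub_pos]
  -- Invariance up to scale of the Hermitian form of signature (n, 2): 1 + |Q|² - 2‖z‖² is its
  -- negative, up to a constant, in the coordinates (z, 1 + Q, 1 - Q).
  have h3 : ‖boostDen r z‖ ^ 2 + ‖boostNum r z‖ ^ 2 - 2 * ((1 - sqLen r) ^ 2 * ‖z‖ ^ 2 +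
      2 * (1 - sqLen r) * (conj (2 * realPair r z - 1 - quadSum z) * realPair r z).re +
      ‖2 * realPair r z - 1 - quadSum z‖ ^ 2 * sqLen r) =
      (1 - sqLen r) ^ 2 * (1 + ‖quadSum z‖ ^ 2 - 2 * ‖z‖ ^ 2) := by
    rw [boostDen, boostNum, Complex.sq_norm, Complex.sq_norm, Complex.sq_norm, Complex.sq_norm,
      Complex.normSq_apply, Complex.normSq_apply, Complex.normSq_apply, Complex.normSq_apply]
    simp
    ring
  have h4 : 0 < (1 - sqLen r) ^ 2 * (1 + ‖quadSum z‖ ^ 2 - 2 * ‖z‖ ^ 2) :=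
    mul_pos (pow_pos (sub_pos.2 hr) 2) (sub_pos.2 hz.2)
  rw [← h3] at h4
  have h5 := div_pos h4 (pow_pos h2 2)
  refine h5.trans_eq ?_
  field_simp

theorem boost_neg_boost {r : Fin n → ℝ} (hr : sqLen r < 1) {z : EuclideanSpace ℂ (Fin n)}
    (hz : z ∈ lieBall n) : boost (-r) (boost r z) = z := by
  have h0 := boostDen_ne_zero hr hz
  have hk : (1 - sqLen r : ℂ) ≠ 0 := by
    have : (1 - sqLen r : ℝ) ≠ 0 := (sub_pos.2 hr).ne'
    exact_mod_cast this
  have hQ : quadSum (boost r z) = boostNum r z / boostDen r z := by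
    rw [boost, quadSum_smul, quadSum_boostVec]; field_simp
  have hl : realPair r (boost r z) = ((1 - sqLen r) * realPair r z +
      (2 * realPair r z - 1 - quadSum z) * sqLen r) / boostDen r z := by
    rw [boost, realPair_smul, realPair_boostVec]; field_simp
  have hd : boostDen (-r) (boost r z) = (1 - sqLen r) ^ 2 / boostDen r z := by
    rw [boostDen, sqLen_neg, realPair_neg, hQ, hl]
    field_simp
    rw [boostNum, boostDen]
    ring
  ext j
  rw [boost_apply, hd, sqLen_neg, realPair_neg, hQ, hl, boost_apply]
  simp only [Pi.neg_apply, Complex.ofReal_neg]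
  field_simp
  rw [boostNum, boostDen]
  ring

theorem realPair_cons (r : Fin n → ℝ) (z : EuclideanSpace ℂ (Fin (n + 1))) :
    realPair (Fin.cons 0 r) z = realPair r (dropFirst z) := by
  simp [realPair, Fin.sum_univ_succ]

theorem sqLen_cons (r : Fin n → ℝ) : sqLen (Fin.cons 0 r : Fin (n + 1) → ℝ) = sqLen r := by
  simp [sqLen, Fin.sum_univ_succ]

theorem differentiableOn_boost (r : Fin n → ℝ) :
    DifferentiableOn ℂ (boost r) {z | boostDen r z ≠ 0} := by
  have h1 := differentiable_quadSum n
  have h2 := differentiable_realPair r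
  rw [differentiableOn_euclidean]
  intro j
  simp only [boost_apply]
  refine DifferentiableOn.mul (DifferentiableOn.inv ?_ fun z hz => hz) ?_
  · unfold boostDen; fun_prop
  · fun_prop

/-- The map of `𝕃_{n+1}` that is covered by a boost. -/
noncomputable def boostImage (r : Fin n → ℝ) (w : EuclideanSpace ℂ (Fin (n + 1))) :
    EuclideanSpace ℂ (Fin (n + 1)) :=
  let q := w 0 + quadSum (dropFirst w)
  let l := realPair r (dropFirst w)
  let d := 1 + sqLen r * q - 2 * l
  WithLp.toLp 2 (Fin.cons (d⁻¹ ^ 2 * ((1 - sqLen r) ^ 2 * w 0)) fun j =>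
    d⁻¹ * ((1 - sqLen r) * w j.succ + (2 * l - 1 - q) * r j))

/-- The parameter (0, r) makes the first coordinate of the boost a multiple of z₀ and lets z₀ enter
everything else only through z₀². Squaring the first coordinate thus gives a map of w₀ = z₀², namely
`boostImage`. -/
theorem isLift_boost {r : Fin n → ℝ} (hr : sqLen r < 1) :
    IsLift n (boost r) (boost (Fin.cons 0 r)) (boostImage r) := by
  have hr' : sqLen (Fin.cons 0 r : Fin (n + 1) → ℝ) < 1 := by rwa [sqLen_cons]
  refine ⟨fun z hz => boost_mem_lieBall hr' hz, ?_, ?_, fun z hz => ?_, fun z hz => ?_⟩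
  · exact ((differentiableOn_boost _).mono fun z hz => boostDen_ne_zero hr' hz
      ).holomorphicOnSet (isOpen_lieBall _)
  · have h1 := (differentiable_quadSum n).comp (differentiable_dropFirst n)
    have h2 := (differentiable_realPair r).comp (differentiable_dropFirst n)
    simp only [Function.comp_def] at h1 h2
    have hD : Differentiable ℂ fun w : EuclideanSpace ℂ (Fin (n + 1)) =>
        1 + sqLen r * (w 0 + quadSum (dropFirst w)) - 2 * realPair r (dropFirst w) := by fun_prop
    refine holomorphicOnSet_of_subset_isOpen ⟨{w | 1 + sqLen r *
      (w 0 + quadSum (dropFirst w)) - 2 * realPair r (dropFirst w) ≠ 0},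
      isOpen_ne_fun hD.continuous continuous_const, ?_, ?_⟩
    · rintro _ ⟨z, hz, rfl⟩
      have h := boostDen_ne_zero hr' hz
      rw [boostDen, sqLen_cons, quadSum_succ, realPair_cons] at h
      exact h
    · have hI := hD.differentiableOn.inv fun (w : EuclideanSpace ℂ (Fin (n + 1))) (hw : w ∈ {w |
        1 + sqLen r * (w 0 + quadSum (dropFirst w)) - 2 * realPair r (dropFirst w) ≠ 0}) => hw
      rw [differentiableOn_euclidean]
      intro j
      refine Fin.cases ?_ (fun j => ?_) j
      · simp only [boostImage, Fin.cons_zero]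
        exact (hI.pow 2).mul (by fun_prop)
      · simp only [boostImage, Fin.cons_succ]
        have h3 : Differentiable ℂ fun w : EuclideanSpace ℂ (Fin (n + 1)) =>
          (1 - sqLen r) * w j.succ + (2 * realPair r (dropFirst w) - 1 -
            (w 0 + quadSum (dropFirst w))) * r j := by fun_prop
        exact hI.mul h3.differentiableOn
  · refine ext_succ ?_ fun j => ?_
    · rw [squareFirst_zero, boost_apply, boostDen, sqLen_cons, realPair_cons, quadSum_succ]
      simp only [boostImage, Fin.cons_zero]
      change (1 + _ * (z 0 ^ 2 + quadSum (dropFirst z)) - 2 * realPair r (dropFirst z))⁻¹ ^ 2 *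
        (_ * z 0 ^ 2) = _
      generalize (1 + sqLen r * (z 0 ^ 2 + quadSum (dropFirst z)) -
        2 * realPair r (dropFirst z))⁻¹ = d
      simp
      ring
    · rw [squareFirst_succ, boost_apply, boostDen, sqLen_cons, realPair_cons, quadSum_succ]
      rfl
  · refine ext_succ ?_ fun j => ?_
    · rw [boost_apply]; simp
    · rw [consZero_succ, boost_apply, boost_apply, boostDen, boostDen, sqLen_cons, realPair_cons,
        quadSum_succ]
      simp

theorem liftable_boost {r : Fin n → ℝ} (hr : sqLen r < 1) : Liftable n (boost r) (boost (-r)) := by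
  have hr' : sqLen (Fin.cons 0 r : Fin (n + 1) → ℝ) < 1 := by rwa [sqLen_cons]
  have h : (Fin.cons 0 (-r) : Fin (n + 1) → ℝ) = -Fin.cons 0 r := by
    ext j
    refine Fin.cases ?_ (fun j => ?_) j <;> simp
  refine ⟨_, _, _, _, isLift_boost hr, isLift_boost (by simpa using hr), ?_, ?_⟩
  · intro z hz
    rw [h, boost_neg_boost hr' hz]
  · intro z hz
    have := boost_neg_boost (r := -Fin.cons 0 r) (by rwa [sqLen_neg]) hz
    rwa [neg_neg, ← h] at this

end Boost

/-! ### Transitivity of the liftable automorphisms. -/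

section Transitive

variable {n : ℕ}

theorem liftable_phase {l : ℂ} (hl : ‖l‖ = 1) :
    Liftable n (fun z => l • z) (fun z => l⁻¹ • z) := by
  have h0 : l ≠ 0 := by rintro rfl; simp at hl
  exact liftable_linear (A := l • ContinuousLinearMap.id ℂ _)
    (A' := l⁻¹ • ContinuousLinearMap.id ℂ _) (c := l ^ 2) (by simp [hl])
    (fun z => by simp [norm_smul, hl]) (fun z => by simp [quadSum_smul])
    (fun z => by simp [smul_smul, h0]) (fun z => by simp [smul_smul, h0])

theorem exists_boost_eq_zero {b : EuclideanSpace ℂ (Fin n)} (hb : b ∈ lieBall n)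
    {r : Fin n → ℝ} (hr : ∀ j, b j = r j) : sqLen r < 1 ∧ boost r b = 0 := by
  have h1 : ‖b‖ ^ 2 = sqLen r := by
    rw [EuclideanSpace.norm_sq_eq, sqLen]
    exact Finset.sum_congr rfl fun j _ => by rw [hr, Complex.norm_real, Real.norm_eq_abs, sq_abs]
  have h2 : quadSum b = sqLen r := by simp [quadSum, sqLen, hr]
  have h3 : realPair r b = sqLen r := by simp [realPair, sqLen, hr, pow_two]
  have h4 := norm_lt_one_of_mem_lieBall hb
  refine ⟨by nlinarith [norm_nonneg b], ?_⟩
  ext j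
  rw [boost_apply, h2, h3, hr]
  simp
  right
  ring

/-- For x > 0 this is the smaller root of xp² - 2tp + 1 = 0; the roots have product 1/x, hence p²x <
1. Writing it as 1/(t + √(t² - x)) also covers x = 0. -/
theorem exists_half_boost_parameter {t x : ℝ} (ht : 0 < t) (hx : x < t ^ 2) :
    ∃ p : ℝ, 1 + p ^ 2 * x = 2 * p * t ∧ p ^ 2 * x < 1 := by
  have hw : 0 < √(t ^ 2 - x) := Real.sqrt_pos.2 (sub_pos.2 hx)
  have hw2 : √(t ^ 2 - x) ^ 2 = t ^ 2 - x := Real.sq_sqrt (sub_pos.2 hx).le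
  generalize √(t ^ 2 - x) = w at hw hw2
  have h0 : 0 < t + w := by positivity
  refine ⟨(t + w)⁻¹, ?_, ?_⟩
  · field_simp
    linarith
  · rw [inv_pow, inv_mul_lt_iff₀ (by positivity)]
    nlinarith

/-- A boost along `rotRe b` can cancel the real part of the image vector once it is rotated by
conj(1 - Q(b)). What is left is i times a real vector, so the image is a complex multiple of a real
vector. -/
theorem exists_boost_eq_smul_real {b : EuclideanSpace ℂ (Fin n)} (hb : b ∈ lieBall n) :
    ∃ r : Fin n → ℝ, sqLen r < 1 ∧ ∃ (m : ℂ) (y : Fin n → ℝ), m ≠ 0 ∧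
      ∀ j, boost r b j = m * y j := by
  have h1 := four_mul_sqLen_rotRe_lt hb
  have hb' := (mem_lieBall_iff b).1 hb
  have hQ : ‖quadSum b‖ ^ 2 < 1 := by nlinarith [norm_nonneg (quadSum b)]
  -- In `hZ` the real part is `rotRe b j` times 1 + p²x - 2pt, which this p makes zero; p²x < 1 is
  -- the admissibility of the boost.
  obtain ⟨p, hp, hp1⟩ := exists_half_boost_parameter (t := (1 - ‖quadSum b‖ ^ 2) / 2)
    (x := sqLen (rotRe b)) (by linarith) (by nlinarith)
  set r : Fin n → ℝ := fun j => p * rotRe b j with hrdef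
  have hR : sqLen r = p ^ 2 * sqLen (rotRe b) := by
    simp only [sqLen, hrdef, mul_pow, Finset.mul_sum]
  have hr : sqLen r < 1 := by rwa [hR]
  set D := 1 - quadSum b with hD
  have hD0 : D ≠ 0 := by
    intro h
    rw [sub_eq_zero] at h
    rw [← h] at hQ
    simp at hQ
  have hl : (conj D * realPair r b).re = p * sqLen (rotRe b) := by
    rw [realPair, Finset.mul_sum, Complex.re_sum, sqLen, Finset.mul_sum]
    refine Finset.sum_congr rfl fun j _ => ?_
    simp only [hrdef, pow_two]
    conv_rhs => rw [rotRe, ← hD]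
    simp
    rw [rotRe, ← hD]
    simp
    ring
  have hT : (conj D * (1 + quadSum b)).re = 1 - ‖quadSum b‖ ^ 2 := by
    rw [hD, Complex.sq_norm, Complex.normSq_apply]
    simp
    ring
  have hs := boostDen_ne_zero hr hb
  have hZ : ∀ j, (conj D * boostVec r b j).re = 0 := by
    intro j
    have h2 : conj D * boostVec r b j = ((1 - sqLen r : ℝ) : ℂ) * (conj D * b j) +
        (r j : ℂ) * (2 * (conj D * realPair r b) - conj D * (1 + quadSum b)) := by
      simp only [boostVec]
      push_cast
      ring
    have h3 : (2 * (conj D * realPair r b)).re = 2 * (p * sqLen (rotRe b)) := by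
      rw [← hl]; simp
    rw [h2, Complex.add_re, Complex.re_ofReal_mul, Complex.re_ofReal_mul, Complex.sub_re, hT, h3, hR]
    change (1 - p ^ 2 * sqLen (rotRe b)) * rotRe b j + p * rotRe b j * _ = 0
    linear_combination rotRe b j * hp
  have hD1 : conj D ≠ 0 := (map_ne_zero _).2 hD0
  refine ⟨r, hr, Complex.I / (conj D * boostDen r b), fun j => (conj D * boostVec r b j).im,
    div_ne_zero Complex.I_ne_zero (mul_ne_zero hD1 hs), fun j => ?_⟩
  have h3 : conj D * boostVec r b j = (conj D * boostVec r b j).im * Complex.I := by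
    apply Complex.ext
    · rw [hZ]; simp
    · simp
  rw [boost, PiLp.smul_apply, smul_eq_mul]
  field_simp
  rw [mul_comm _ (conj D), mul_comm Complex.I]
  exact h3

theorem exists_liftable_eq_zero {b : EuclideanSpace ℂ (Fin n)} (hb : b ∈ lieBall n) :
    ∃ f f', Liftable n f f' ∧ f b = 0 := by
  obtain ⟨r, hr, m, y, hm, hy⟩ := exists_boost_eq_smul_real hb
  have hm' : (‖m‖ : ℂ) ≠ 0 := by simpa using hm
  -- The phase |m|/m turns m y into the real vector |m| y, which a second boost takes to 0.
  have hl : ‖(‖m‖ / m : ℂ)‖ = 1 := by simp [hm]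
  have h1 := (liftable_phase hl).comp (liftable_boost hr)
  obtain ⟨h2, h3⟩ := exists_boost_eq_zero (h1.mapsTo hb) (r := fun j => ‖m‖ * y j) fun j => by
    simp [hy]
    field_simp
  exact ⟨_, _, (liftable_boost h2).comp h1, h3⟩

end Transitive

/-! ### The derivative at the origin. -/

section LinearPart

variable {n : ℕ}

theorem smul_mem_lieBall_of_quadSum_eq_one {x : EuclideanSpace ℂ (Fin n)} (hQ : quadSum x = 1)
    (hx : ‖x‖ = 1) {c : ℂ} (hc : ‖c‖ < 1) : c • x ∈ lieBall n := by
  rw [mem_lieBall_iff, quadSum_smul, norm_smul, hQ, hx]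
  have h0 := norm_nonneg c
  simp only [norm_pow, mul_one]
  have h2 : ‖c‖ ^ 2 < 1 := by nlinarith
  exact ⟨h2, by nlinarith [pow_pos (sub_pos.2 h2) 2]⟩

/-- With p, m the moduli of z_i ± e z_j and r the contribution of the other coordinates, |Q| ≤ r +
pm and 2‖z‖² = 2r + p² + m². Membership then gives (1 - p²)(1 - m²) > 0 and p² + m² < 2, so p ≥ 1 is
impossible. -/
theorem norm_add_mul_lt_one_of_mem_lieBall {z : EuclideanSpace ℂ (Fin n)} (hz : z ∈ lieBall n)
    {i j : Fin n} (hij : i ≠ j) {e : ℂ} (he : e ^ 2 = -1) : ‖z i + e * z j‖ < 1 := by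
  rw [mem_lieBall_iff] at hz
  have hen : ‖e‖ = 1 := by
    have : ‖e‖ ^ 2 = 1 := by rw [← norm_pow, he]; simp
    exact (pow_eq_one_iff_of_nonneg (norm_nonneg _) two_ne_zero).1 this
  have hsub : ({i, j} : Finset (Fin n)) ⊆ Finset.univ := Finset.subset_univ _
  set q := ∑ k ∈ Finset.univ \ {i, j}, z k ^ 2 with hq
  set r := ∑ k ∈ Finset.univ \ {i, j}, ‖z k‖ ^ 2 with hr
  have hqr : ‖q‖ ≤ r := (norm_sum_le _ _).trans (le_of_eq (by simp [hr]))
  have hQ : quadSum z = q + (z i + e * z j) * (z i - e * z j) := by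
    rw [quadSum, ← Finset.sum_sdiff hsub, Finset.sum_pair hij]
    linear_combination (z j) ^ 2 * he
  have hS : 2 * ‖z‖ ^ 2 = 2 * r + (‖z i + e * z j‖ ^ 2 + ‖z i - e * z j‖ ^ 2) := by
    have h1 := parallelogram_law_with_norm ℂ (z i) (e * z j)
    have h2 : ‖e * z j‖ = ‖z j‖ := by rw [norm_mul, hen, one_mul]
    rw [h2] at h1
    rw [EuclideanSpace.norm_sq_eq, ← Finset.sum_sdiff hsub, Finset.sum_pair hij]
    linarith
  have hQn : ‖quadSum z‖ ≤ r + ‖z i + e * z j‖ * ‖z i - e * z j‖ := by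
    rw [hQ, ← norm_mul]
    exact (norm_add_le _ _).trans (by gcongr)
  rw [hS] at hz
  have hr0 : 0 ≤ r := (norm_nonneg _).trans hqr
  have h0 := norm_nonneg (quadSum z)
  generalize ‖quadSum z‖ = Q at *
  have hp := norm_nonneg (z i + e * z j)
  have hm := norm_nonneg (z i - e * z j)
  generalize ‖z i + e * z j‖ = p at *
  generalize ‖z i - e * z j‖ = m at *
  obtain ⟨h1, h2⟩ := hz
  have h3 : p ^ 2 + m ^ 2 < 2 - 2 * r := by nlinarith
  have h4 : p * m < 1 - r := by nlinarith [sq_nonneg (p - m)]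
  have h5 : Q ^ 2 ≤ (r + p * m) ^ 2 := by gcongr
  have h6 : 0 < (1 - p ^ 2) * (1 - m ^ 2) := by
    nlinarith [mul_nonneg hr0 (sub_pos.2 h4).le, mul_nonneg hr0 hr0]
  by_contra hcon
  push Not at hcon
  have h7 : 1 ≤ p ^ 2 := one_le_pow₀ hcon
  nlinarith

/-- Letting t tend to 1/2, failure of membership suggests 1 + |Q(y)|²/16 ≤ ‖y‖²/2 as long as |Q(y)|
< 4. Hence ‖y‖² ≥ 2, and equality leaves no room for Q(y). -/
theorem two_le_norm_sq_and_quadSum_eq_zero {y : EuclideanSpace ℂ (Fin n)}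
    (h : ∀ t : ℝ, 1 / 2 < t → (t : ℂ) • y ∉ lieBall n) :
    2 ≤ ‖y‖ ^ 2 ∧ (‖y‖ ^ 2 = 2 → quadSum y = 0) := by
  have key : ∀ τ : ℝ, 1 / 4 < τ → τ * ‖quadSum y‖ < 1 →
      1 + τ ^ 2 * ‖quadSum y‖ ^ 2 ≤ 2 * (τ * ‖y‖ ^ 2) := by
    intro τ hτ h1
    by_contra! h2
    have h0 : 0 ≤ τ := by linarith
    refine h √τ (Real.lt_sqrt_of_sq_lt (by linarith)) ?_
    have h3 : ‖((√τ : ℝ) : ℂ)‖ ^ 2 = τ := by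
      rw [Complex.norm_real, Real.norm_eq_abs, sq_abs, Real.sq_sqrt h0]
    rw [mem_lieBall_iff, quadSum_smul, norm_smul, mul_pow, norm_mul, norm_pow, h3, mul_pow]
    exact ⟨h1, h2⟩
  have hq := norm_quadSum_le y
  have h0 := norm_nonneg (quadSum y)
  constructor
  · by_contra! hlt
    -- Only τ = t² > 1/4 is allowed, so τ exceeds 1/4 by a small multiple of the assumed gap; the
    -- equality case below does the same with |Q(y)|².
    have h1 := key (1 / 4 + (2 - ‖y‖ ^ 2) / 16) (by linarith)
      (by nlinarith [sq_nonneg ‖y‖])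
    nlinarith [sq_nonneg ((1 / 4 + (2 - ‖y‖ ^ 2) / 16) * ‖quadSum y‖), sq_nonneg ‖y‖]
  · intro h2
    by_contra hne
    have h3 : 0 < ‖quadSum y‖ := norm_pos_iff.2 hne
    rw [h2] at hq key
    have h4 : 0 < ‖quadSum y‖ ^ 2 := by positivity
    have h5 := key (1 / 4 + ‖quadSum y‖ ^ 2 / 64) (by linarith) (by nlinarith)
    nlinarith [mul_pos h4 h4, mul_pos h4 (mul_pos h4 h4)]

/-- The bilinear form of the quadratic form `∑ z_j²`. -/
def bilinSum (z w : EuclideanSpace ℂ (Fin n)) : ℂ := ∑ j, z j * w j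

theorem quadSum_sub_smul (z w : EuclideanSpace ℂ (Fin n)) (e : ℂ) :
    quadSum (z - e • w) = quadSum z + e ^ 2 * quadSum w - 2 * e * bilinSum z w := by
  simp only [quadSum, bilinSum, Finset.mul_sum, ← Finset.sum_add_distrib, ← Finset.sum_sub_distrib]
  refine Finset.sum_congr rfl fun k _ => ?_
  simp
  ring

theorem quadSum_single (i : Fin n) : quadSum (EuclideanSpace.single i (1 : ℂ)) = 1 := by
  rw [quadSum, Finset.sum_eq_single i] <;> simp +contextual

theorem bilinSum_single {i j : Fin n} (h : i ≠ j) :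
    bilinSum (EuclideanSpace.single i (1 : ℂ)) (EuclideanSpace.single j 1) = 0 := by
  rw [bilinSum, Finset.sum_eq_single i] <;> simp +contextual [h]

theorem norm_sq_single_add {i j : Fin n} (h : i ≠ j) {s : ℂ} :
    ‖EuclideanSpace.single i (1 : ℂ) - s • EuclideanSpace.single j 1‖ ^ 2 = 1 + ‖s‖ ^ 2 := by
  rw [norm_sub_sq (𝕜 := ℂ), inner_smul_right, EuclideanSpace.inner_single_left]
  simp [h, norm_smul]

/-- The bounds of the Schwarz lemma for the derivative at `0` of an automorphism of the Lie ball
fixing `0`, and for its inverse. -/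
structure SchwarzBounds (A A' : EuclideanSpace ℂ (Fin n) →L[ℂ] EuclideanSpace ℂ (Fin n)) :
    Prop where
  left_inv : ∀ z, A' (A z) = z
  norm_le : ∀ x, quadSum x = 1 → ‖x‖ = 1 → ‖A x‖ ≤ 1
  norm_le' : ∀ x, quadSum x = 1 → ‖x‖ = 1 → ‖A' x‖ ≤ 1
  norm_add_mul_le : ∀ y ∈ lieBall n, ∀ i j : Fin n, ∀ e : ℂ, i ≠ j → e ^ 2 = -1 →
    ‖A' y i + e * A' y j‖ ≤ 1

namespace SchwarzBounds

variable {A A' : EuclideanSpace ℂ (Fin n) →L[ℂ] EuclideanSpace ℂ (Fin n)}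

/-- The functional z_i + e z_j takes the value 2 at e_i - e e_j and is bounded by 1 on the image of
the Lie ball under A', so tA(e_i - e e_j) leaves the Lie ball for t > 1/2. -/
theorem image_pair (h : SchwarzBounds A A') {i j : Fin n} (hij : i ≠ j) {e : ℂ} (he : e ^ 2 = -1) :
    2 ≤ ‖A (EuclideanSpace.single i 1) - e • A (EuclideanSpace.single j 1)‖ ^ 2 ∧
    (‖A (EuclideanSpace.single i 1) - e • A (EuclideanSpace.single j 1)‖ ^ 2 = 2 →
      quadSum (A (EuclideanSpace.single i 1) - e • A (EuclideanSpace.single j 1)) = 0) := by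
  refine two_le_norm_sq_and_quadSum_eq_zero fun t ht hmem => ?_
  have h1 := h.norm_add_mul_le _ hmem i j e hij he
  rw [← map_smul, ← map_sub, map_smul, h.left_inv] at h1
  have h2 : ((t : ℂ) • (EuclideanSpace.single i (1 : ℂ) - e • EuclideanSpace.single j 1) :
      EuclideanSpace ℂ (Fin n)) i + e * ((t : ℂ) • (EuclideanSpace.single i (1 : ℂ) -
      e • EuclideanSpace.single j 1) : EuclideanSpace ℂ (Fin n)) j = ((2 * t : ℝ) : ℂ) := by
    simp [hij, hij.symm]
    linear_combination -(t : ℂ) * he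
  rw [h2, Complex.norm_real, Real.norm_eq_abs, abs_of_pos (by linarith)] at h1
  linarith

theorem norm_image_le (h : SchwarzBounds A A') (i : Fin n) : ‖A (EuclideanSpace.single i 1)‖ ≤ 1 :=
  h.norm_le _ (quadSum_single i) (by simp)

/-- By the parallelogram law the squared norms of Ae_i ± e Ae_j sum to at most 4, while each is at
least 2; all the inequalities are therefore equalities. -/
theorem norm_eq_of_ne (h : SchwarzBounds A A') {i j : Fin n} (hij : i ≠ j) {e : ℂ}
    (he : e ^ 2 = -1) : ‖A (EuclideanSpace.single i 1)‖ = 1 ∧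
      ‖A (EuclideanSpace.single i 1) - e • A (EuclideanSpace.single j 1)‖ ^ 2 = 2 := by
  have h1 := (h.image_pair hij he).1
  have h2 := (h.image_pair hij (e := -e) (by rwa [neg_sq])).1
  have hen : ‖e‖ = 1 := by
    have : ‖e‖ ^ 2 = 1 := by rw [← norm_pow, he]; simp
    exact (pow_eq_one_iff_of_nonneg (norm_nonneg _) two_ne_zero).1 this
  have h3 := parallelogram_law_with_norm ℂ (A (EuclideanSpace.single i 1))
    (e • A (EuclideanSpace.single j 1))
  rw [norm_smul, hen, one_mul] at h3
  rw [neg_smul, sub_neg_eq_add] at h2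
  have h4 := h.norm_image_le i
  have h5 := h.norm_image_le j
  have h6 := norm_nonneg (A (EuclideanSpace.single i 1))
  have h7 := norm_nonneg (A (EuclideanSpace.single j 1))
  constructor <;> nlinarith

theorem norm_image (h : SchwarzBounds A A') (i : Fin n) : ‖A (EuclideanSpace.single i 1)‖ = 1 := by
  by_cases hn : ∃ j, i ≠ j
  · obtain ⟨j, hij⟩ := hn
    exact (h.norm_eq_of_ne hij Complex.I_sq).1
  -- With a single coordinate there is no pair to use; A is then a scalar, and the bounds on A and
  -- A' give it modulus 1.
  · push Not at hn
    have h1 : A (EuclideanSpace.single i 1) =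
        (A (EuclideanSpace.single i 1) i) • EuclideanSpace.single i 1 := by
      ext j
      simp [← hn j]
    have h2 := h.left_inv (EuclideanSpace.single i 1)
    rw [h1, map_smul] at h2
    have h3 := congrArg norm h2
    rw [norm_smul] at h3
    have h4 := congrArg norm h1
    rw [norm_smul] at h4
    have h5 := h.norm_le' _ (quadSum_single i) (by simp)
    have h6 := h.norm_image_le i
    simp only [PiLp.norm_single, norm_one, mul_one] at h3 h4
    rw [← h4] at h3
    nlinarith [norm_nonneg (A (EuclideanSpace.single i 1))]

theorem norm_sub_smul_le (h : SchwarzBounds A A') {i j : Fin n} (hij : i ≠ j) {s : ℂ}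
    (hs : s ^ 2 = 1) :
    ‖A (EuclideanSpace.single i 1) - s • A (EuclideanSpace.single j 1)‖ ^ 2 ≤ 2 := by
  have hsn : ‖s‖ = 1 := by
    have : ‖s‖ ^ 2 = 1 := by rw [← norm_pow, hs]; simp
    exact (pow_eq_one_iff_of_nonneg (norm_nonneg _) two_ne_zero).1 this
  set x := EuclideanSpace.single i (1 : ℂ) - s • EuclideanSpace.single j 1 with hx
  have h2 : (0 : ℝ) ≤ 2 := zero_le_two
  have hxn : ‖x‖ = √2 := by
    rw [← Real.sqrt_sq (norm_nonneg x), hx, norm_sq_single_add hij, hsn]; norm_num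
  have hxQ : quadSum x = 2 := by
    rw [hx, quadSum_sub_smul, quadSum_single, quadSum_single, bilinSum_single hij, hs]; norm_num
  have h3 := h.norm_le (((√2)⁻¹ : ℝ) • x : EuclideanSpace ℂ (Fin n)) (by
    rw [← Complex.coe_smul, quadSum_smul, hxQ, ← Complex.ofReal_pow, inv_pow, Real.sq_sqrt h2]
    norm_num) (by
    rw [norm_smul, hxn, norm_inv, Real.norm_of_nonneg (Real.sqrt_nonneg _)]
    exact inv_mul_cancel₀ (by positivity))
  rw [← Complex.coe_smul, map_smul, norm_smul, Complex.norm_real, norm_inv,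
    Real.norm_of_nonneg (Real.sqrt_nonneg _), inv_mul_le_iff₀ (by positivity), mul_one, hx,
    map_sub, map_smul] at h3
  calc _ ≤ √2 ^ 2 := by gcongr
    _ = 2 := Real.sq_sqrt h2

/-- The upper bounds for s = ±1 kill the real part of the inner product; the exact value for e = i
kills the imaginary part. -/
theorem inner_image (h : SchwarzBounds A A') {i j : Fin n} (hij : i ≠ j) :
    inner ℂ (A (EuclideanSpace.single i 1)) (A (EuclideanSpace.single j 1)) = 0 := by
  have h1 := (h.norm_eq_of_ne hij Complex.I_sq).2
  have h2 := h.norm_sub_smul_le hij (s := 1) (by simp)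
  have h3 := h.norm_sub_smul_le hij (s := -1) (by simp)
  rw [norm_sub_sq (𝕜 := ℂ), inner_smul_right, norm_smul, h.norm_image, h.norm_image] at h1 h2 h3
  simp at h1 h2 h3
  apply Complex.ext
  · simp only [Complex.zero_re]; linarith
  · simp only [Complex.zero_im]; linarith

/-- Equality in `image_pair` makes A(e_i ∓ i e_j) null for Q; adding and subtracting the two
equations separates the claims. -/
theorem quadSum_image (h : SchwarzBounds A A') {i j : Fin n} (hij : i ≠ j) :
    quadSum (A (EuclideanSpace.single i 1)) = quadSum (A (EuclideanSpace.single j 1)) ∧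
    bilinSum (A (EuclideanSpace.single i 1)) (A (EuclideanSpace.single j 1)) = 0 := by
  have key : ∀ e : ℂ, e ^ 2 = -1 → _ := fun e he =>
    (h.image_pair hij he).2 (h.norm_eq_of_ne hij he).2
  have h1 := key Complex.I Complex.I_sq
  have h2 := key (-Complex.I) (by simp)
  rw [quadSum_sub_smul] at h1 h2
  simp only [neg_sq, Complex.I_sq] at h1 h2
  constructor
  · linear_combination (h1 + h2) / 2
  · have : Complex.I ^ 2 = -1 := Complex.I_sq
    linear_combination (Complex.I / 4) * (h1 - h2) +
      bilinSum (A (EuclideanSpace.single i 1)) (A (EuclideanSpace.single j 1)) * this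

theorem apply_eq_sum (A : EuclideanSpace ℂ (Fin n) →L[ℂ] EuclideanSpace ℂ (Fin n))
    (z : EuclideanSpace ℂ (Fin n)) : A z = ∑ i, z i • A (EuclideanSpace.single i 1) := by
  have h : z = ∑ i, z i • EuclideanSpace.single i (1 : ℂ) := by
    simpa using ((EuclideanSpace.basisFun (Fin n) ℂ).sum_repr z).symm
  conv_lhs => rw [h]
  simp

theorem norm_apply (h : SchwarzBounds A A') (z : EuclideanSpace ℂ (Fin n)) : ‖A z‖ = ‖z‖ := by
  have h1 : Orthonormal ℂ (A.toLinearMap ∘ (EuclideanSpace.basisFun (Fin n) ℂ).toBasis) := by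
    refine ⟨fun i => ?_, fun i j hij => ?_⟩
    · simpa using h.norm_image i
    · simpa using h.inner_image hij
  have h2 : Orthonormal ℂ (EuclideanSpace.basisFun (Fin n) ℂ).toBasis := by
    simp [(EuclideanSpace.basisFun (Fin n) ℂ).orthonormal]
  exact (A.toLinearMap.isometryOfOrthonormal h2 h1).norm_map z

theorem quadSum_apply (h : SchwarzBounds A A') (i₀ : Fin n) (z : EuclideanSpace ℂ (Fin n)) :
    quadSum (A z) = quadSum (A (EuclideanSpace.single i₀ 1)) * quadSum z := by
  set v : Fin n → EuclideanSpace ℂ (Fin n) := fun i => A (EuclideanSpace.single i 1) with hv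
  have h1 : ∀ i, bilinSum (v i) (v i) = quadSum (v i₀) := by
    intro i
    have : bilinSum (v i) (v i) = quadSum (v i) := by simp [bilinSum, quadSum, pow_two]
    rw [this]
    rcases eq_or_ne i i₀ with rfl | hi
    · rfl
    · exact (h.quadSum_image hi).1
  have h2 : ∀ k, A z k = ∑ i, z i * v i k := by
    intro k
    rw [apply_eq_sum A z]
    simp [hv]
  calc quadSum (A z) = ∑ k, ∑ i, ∑ j, z i * z j * (v i k * v j k) := by
        rw [quadSum]
        refine Finset.sum_congr rfl fun k _ => ?_
        rw [h2, pow_two, Finset.sum_mul_sum]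
        exact Finset.sum_congr rfl fun i _ => Finset.sum_congr rfl fun j _ => by ring
    _ = ∑ i, ∑ j, z i * z j * bilinSum (v i) (v j) := by
        rw [Finset.sum_comm]
        refine Finset.sum_congr rfl fun i _ => ?_
        rw [Finset.sum_comm]
        simp only [bilinSum, Finset.mul_sum]
    _ = ∑ i, z i ^ 2 * quadSum (v i₀) := by
        refine Finset.sum_congr rfl fun i _ => ?_
        rw [Finset.sum_eq_single i, h1, pow_two]
        · intro j _ hj
          rw [(h.quadSum_image hj.symm).2, mul_zero]
        · simp
    _ = _ := by rw [← Finset.sum_mul, mul_comm, ← quadSum]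

end SchwarzBounds

theorem liftable_of_schwarzBounds (hn : 1 ≤ n)
    {A A' : EuclideanSpace ℂ (Fin n) →L[ℂ] EuclideanSpace ℂ (Fin n)}
    (h : SchwarzBounds A A') (h' : SchwarzBounds A' A) : Liftable n A A' := by
  let i₀ : Fin n := ⟨0, hn⟩
  refine liftable_linear ?_ h.norm_apply (h.quadSum_apply i₀) h.left_inv h'.left_inv
  set c := quadSum (A (EuclideanSpace.single i₀ 1)) with hc
  have key : ∀ {B B' : EuclideanSpace ℂ (Fin n) →L[ℂ] EuclideanSpace ℂ (Fin n)},
      SchwarzBounds B B' → ‖quadSum (B (EuclideanSpace.single i₀ 1))‖ ≤ 1 := by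
    intro B B' hB
    refine (norm_quadSum_le _).trans ?_
    rw [hB.norm_image]; simp
  have h1 := key h
  have h2 := key h'
  -- This gives c · Q(A'e) = 1 with both factors of modulus at most 1, so |c| = 1.
  have h3 := h.quadSum_apply i₀ (A' (EuclideanSpace.single i₀ 1))
  rw [h'.left_inv, quadSum_single] at h3
  have h4 := congrArg norm h3
  rw [norm_one, norm_mul] at h4
  nlinarith [norm_nonneg (quadSum (A (EuclideanSpace.single i₀ 1)))]

end LinearPart

/-! ### Automorphisms fixing the origin are linear; the general case. -/

section Cartan

variable {n : ℕ}

theorem hasDerivAt_comp_smul {F : Type*} [NormedAddCommGroup F] [NormedSpace ℂ F]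
    {f : EuclideanSpace ℂ (Fin n) → F} (hf : DifferentiableAt ℂ f 0)
    (y : EuclideanSpace ℂ (Fin n)) :
    HasDerivAt (fun c : ℂ => f (c • y)) (fderiv ℂ f 0 y) 0 := by
  have h1 : HasDerivAt (fun c : ℂ => c • y) y 0 := by
    simpa using (hasDerivAt_id (0 : ℂ)).smul_const y
  have h2 : HasFDerivAt f (fderiv ℂ f 0) ((0 : ℂ) • y) := by
    rw [zero_smul]; exact hf.hasFDerivAt
  exact h2.comp_hasDerivAt 0 h1

theorem differentiableOn_comp_smul {F : Type*} [NormedAddCommGroup F] [NormedSpace ℂ F]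
    {f : EuclideanSpace ℂ (Fin n) → F} (hf : DifferentiableOn ℂ f (lieBall n))
    {y : EuclideanSpace ℂ (Fin n)} {s : Set ℂ} (hy : ∀ c ∈ s, c • y ∈ lieBall n) :
    DifferentiableOn ℂ (fun c : ℂ => f (c • y)) s :=
  hf.comp (by fun_prop : Differentiable ℂ fun c : ℂ => c • y).differentiableOn hy

theorem differentiableAt_zero_of_lieBall {F : Type*} [NormedAddCommGroup F] [NormedSpace ℂ F]
    {f : EuclideanSpace ℂ (Fin n) → F} (hf : DifferentiableOn ℂ f (lieBall n)) :
    DifferentiableAt ℂ f 0 :=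
  hf.differentiableAt ((isOpen_lieBall n).mem_nhds (zero_mem_lieBall n))

/-- Schwarz lemma on a linear disc in the Lie ball. -/
theorem norm_fderiv_apply_le_one {F : Type*} [NormedAddCommGroup F] [NormedSpace ℂ F]
    {f : EuclideanSpace ℂ (Fin n) → F} (hf : DifferentiableOn ℂ f (lieBall n)) (h0 : f 0 = 0)
    (hb : ∀ z ∈ lieBall n, ‖f z‖ ≤ 1) {y : EuclideanSpace ℂ (Fin n)}
    (hy : ∀ c : ℂ, ‖c‖ < 1 → c • y ∈ lieBall n) : ‖fderiv ℂ f 0 y‖ ≤ 1 := by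
  rw [← (hasDerivAt_comp_smul (differentiableAt_zero_of_lieBall hf) y).deriv]
  refine Complex.norm_deriv_le_one_of_mapsTo_ball (R := 1)
    (differentiableOn_comp_smul hf fun c hc => hy c (by simpa using hc)) (fun c hc => ?_) one_pos
  simpa [h0] using hb _ (hy c (by simpa using hc))

theorem schwarzBounds_fderiv {f g : EuclideanSpace ℂ (Fin n) → EuclideanSpace ℂ (Fin n)}
    (hf : DifferentiableOn ℂ f (lieBall n)) (hg : DifferentiableOn ℂ g (lieBall n))
    (hfm : MapsTo f (lieBall n) (lieBall n)) (hgm : MapsTo g (lieBall n) (lieBall n))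
    (hgf : LeftInvOn g f (lieBall n)) (hf0 : f 0 = 0) (hg0 : g 0 = 0) :
    SchwarzBounds (fderiv ℂ f 0) (fderiv ℂ g 0) := by
  have hf' := differentiableAt_zero_of_lieBall hf
  have hg' := differentiableAt_zero_of_lieBall hg
  refine ⟨fun z => ?_, fun x hQ hx => ?_, fun x hQ hx => ?_, fun y hy i j e hij he => ?_⟩
  · have h1 : HasFDerivAt (g ∘ f) ((fderiv ℂ g 0).comp (fderiv ℂ f 0)) 0 := by
      refine HasFDerivAt.comp 0 ?_ hf'.hasFDerivAt
      rw [hf0]; exact hg'.hasFDerivAt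
    have h2 : HasFDerivAt (g ∘ f) (ContinuousLinearMap.id ℂ _) 0 :=
      (hasFDerivAt_id _).congr_of_eventuallyEq (by
        filter_upwards [(isOpen_lieBall n).mem_nhds (zero_mem_lieBall n)] with z hz
        exact hgf hz)
    exact DFunLike.congr_fun (h1.unique h2) z
  · exact norm_fderiv_apply_le_one hf hf0 (fun z hz => (norm_lt_one_of_mem_lieBall (hfm hz)).le)
      fun c hc => smul_mem_lieBall_of_quadSum_eq_one hQ hx hc
  · exact norm_fderiv_apply_le_one hg hg0 (fun z hz => (norm_lt_one_of_mem_lieBall (hgm hz)).le)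
      fun c hc => smul_mem_lieBall_of_quadSum_eq_one hQ hx hc
  · let φ : EuclideanSpace ℂ (Fin n) →L[ℂ] ℂ :=
      EuclideanSpace.proj i + e • EuclideanSpace.proj j
    have hφ : ∀ z, φ z = z i + e * z j := fun z => by simp [φ]
    have h1 : fderiv ℂ (φ ∘ g) 0 y = φ (fderiv ℂ g 0 y) := by
      rw [(φ.hasFDerivAt.comp 0 hg'.hasFDerivAt).fderiv]; rfl
    rw [← hφ, ← h1]
    refine norm_fderiv_apply_le_one (φ.differentiable.comp_differentiableOn hg) (by simp [hg0])
      (fun z hz => ?_) fun c hc => smul_mem_lieBall hc.le hy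
    simp only [Function.comp_apply, hφ]
    exact (norm_add_mul_lt_one_of_mem_lieBall (hgm hz) hij he).le

/-- The equality case of the Schwarz lemma on the disc c ↦ c x, with values in the closed unit ball;
strict convexity of the Euclidean norm makes f affine there. -/
theorem eq_smul_fderiv_of_norm_eq_one
    {f : EuclideanSpace ℂ (Fin n) → EuclideanSpace ℂ (Fin n)}
    (hf : DifferentiableOn ℂ f (lieBall n)) (hfm : MapsTo f (lieBall n) (lieBall n))
    (hf0 : f 0 = 0) {x : EuclideanSpace ℂ (Fin n)} (hQ : quadSum x = 1) (hx : ‖x‖ = 1)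
    (hA : ‖fderiv ℂ f 0 x‖ = 1) {c : ℂ} (hc : ‖c‖ < 1) : f (c • x) = c • fderiv ℂ f 0 x := by
  have hd := (hasDerivAt_comp_smul (differentiableAt_zero_of_lieBall hf) x).deriv
  have hm : ∀ c : ℂ, c ∈ ball (0 : ℂ) 1 → c • x ∈ lieBall n := fun c hc =>
    smul_mem_lieBall_of_quadSum_eq_one hQ hx (by simpa using hc)
  have h1 := Complex.affine_of_mapsTo_ball_of_norm_dslope_eq_div (f := fun c : ℂ => f (c • x))
    (c := 0) (R₁ := 1) (R₂ := 1) (z₀ := 0) (differentiableOn_comp_smul hf hm)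
    (fun c hc => by simpa [hf0] using (norm_lt_one_of_mem_lieBall (hfm (hm c hc))).le)
    (by simp) (by rw [dslope_same, hd, hA, div_one])
  have h2 := h1 (show c ∈ ball (0 : ℂ) 1 by simpa using hc)
  simpa [hf0, hd] using h2

/-- The vector with the given real coordinates. -/
def ofRealVec (x : Fin n → ℝ) : EuclideanSpace ℂ (Fin n) := WithLp.toLp 2 fun j => (x j : ℂ)

theorem norm_sq_ofRealVec (x : Fin n → ℝ) : ‖ofRealVec x‖ ^ 2 = sqLen x := by
  simp [EuclideanSpace.norm_sq_eq, ofRealVec, sqLen]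

theorem quadSum_ofRealVec (x : Fin n → ℝ) : quadSum (ofRealVec x) = sqLen x := by
  simp [quadSum, ofRealVec, sqLen]

theorem eq_fderiv_ofRealVec
    {f : EuclideanSpace ℂ (Fin n) → EuclideanSpace ℂ (Fin n)}
    (hf : DifferentiableOn ℂ f (lieBall n)) (hfm : MapsTo f (lieBall n) (lieBall n))
    (hf0 : f 0 = 0) (hA : ∀ z, ‖fderiv ℂ f 0 z‖ = ‖z‖) (x : Fin n → ℝ)
    (hx : ‖ofRealVec x‖ < 1) : f (ofRealVec x) = fderiv ℂ f 0 (ofRealVec x) := by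
  rcases eq_or_ne (ofRealVec x) 0 with h0 | h0
  · rw [h0, hf0, map_zero]
  · set v := ofRealVec x
    have hv : (‖v‖ : ℂ) ≠ 0 := by simpa using h0
    have h1 : ‖(‖v‖ : ℂ)⁻¹ • v‖ = 1 := by rw [norm_smul]; simp [h0]
    have h2 : quadSum ((‖v‖ : ℂ)⁻¹ • v) = 1 := by
      rw [quadSum_smul, quadSum_ofRealVec, ← norm_sq_ofRealVec]
      push_cast
      rw [inv_pow]
      exact inv_mul_cancel₀ (pow_ne_zero 2 hv)
    have h3 := eq_smul_fderiv_of_norm_eq_one hf hfm hf0 h2 h1 (by rw [hA, h1])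
      (c := (‖v‖ : ℂ)) (by simpa using hx)
    rwa [← map_smul, smul_smul, mul_inv_cancel₀ hv, one_smul] at h3

/-- For z = x + iy the maps f and A agree at x + cy for small real c, hence at c = i by the identity
theorem in one variable. -/
theorem eq_of_eq_on_real_disc {f A : EuclideanSpace ℂ (Fin n) → EuclideanSpace ℂ (Fin n)}
    (hf : DifferentiableOn ℂ f (lieBall n)) (hA : Differentiable ℂ A)
    (h : ∀ x : Fin n → ℝ, ‖ofRealVec x‖ < 1 → f (ofRealVec x) = A (ofRealVec x))
    {z : EuclideanSpace ℂ (Fin n)} (hz : ‖z‖ < 1 / 8) : f z = A z := by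
  set x : Fin n → ℝ := fun j => (z j).re with hxdef
  set y : Fin n → ℝ := fun j => (z j).im with hydef
  have hle : ‖ofRealVec x‖ ^ 2 + ‖ofRealVec y‖ ^ 2 = ‖z‖ ^ 2 := by
    rw [norm_sq_ofRealVec, norm_sq_ofRealVec, EuclideanSpace.norm_sq_eq, sqLen, sqLen,
      ← Finset.sum_add_distrib]
    refine Finset.sum_congr rfl fun j _ => ?_
    rw [Complex.sq_norm, Complex.normSq_apply, pow_two, pow_two]
  have hx : ‖ofRealVec x‖ < 1 / 8 := by
    nlinarith [norm_nonneg z, norm_nonneg (ofRealVec x), sq_nonneg ‖ofRealVec y‖]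
  have hy : ‖ofRealVec y‖ < 1 / 8 := by
    nlinarith [norm_nonneg z, norm_nonneg (ofRealVec y), sq_nonneg ‖ofRealVec x‖]
  -- Radius 2 puts i inside the disc, and 1/8 + 2/8 < 1/2 keeps the line inside the ball of
  -- `ball_subset_lieBall`.
  have hb : ∀ c ∈ ball (0 : ℂ) 2, ‖ofRealVec x + c • ofRealVec y‖ < 1 / 2 := by
    intro c hc
    rw [mem_ball_zero_iff] at hc
    have h1 := norm_add_le (ofRealVec x) (c • ofRealVec y)
    rw [norm_smul] at h1
    nlinarith [norm_nonneg c, norm_nonneg (ofRealVec y)]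
  have hline : Differentiable ℂ fun c : ℂ => ofRealVec x + c • ofRealVec y := by fun_prop
  have h1 : DifferentiableOn ℂ (fun c : ℂ => f (ofRealVec x + c • ofRealVec y)) (ball 0 2) :=
    hf.comp hline.differentiableOn fun c hc =>
      ball_subset_lieBall n (mem_ball_zero_iff.2 (hb c hc))
  have h2 : DifferentiableOn ℂ (fun c : ℂ => A (ofRealVec x + c • ofRealVec y)) (ball 0 2) :=
    (hA.comp hline).differentiableOn
  have h3 : ∃ᶠ c : ℂ in 𝓝[≠] 0, f (ofRealVec x + c • ofRealVec y) =
      A (ofRealVec x + c • ofRealVec y) := by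
    have hT : Tendsto (fun t : ℝ => (t : ℂ)) (𝓝[≠] 0) (𝓝[≠] 0) := by
      refine tendsto_nhdsWithin_of_tendsto_nhds_of_eventually_within _ ?_ ?_
      · exact (Complex.continuous_ofReal.tendsto' 0 0 Complex.ofReal_zero).mono_left
          nhdsWithin_le_nhds
      · filter_upwards [self_mem_nhdsWithin] with t ht
        simpa using ht
    refine hT.frequently (Eventually.frequently ?_)
    filter_upwards [nhdsWithin_le_nhds (ball_mem_nhds (0 : ℝ) two_pos)] with t ht
    have h4 : ofRealVec x + (t : ℂ) • ofRealVec y = ofRealVec (x + t • y) := by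
      ext j; simp [ofRealVec]
    have h5 := hb t (by simpa using ht)
    rw [h4] at h5 ⊢
    exact h _ (by linarith)
  have h4 := (h1.analyticOnNhd isOpen_ball).eqOn_of_preconnected_of_frequently_eq
    (h2.analyticOnNhd isOpen_ball) (convex_ball _ _).isPreconnected (mem_ball_self two_pos) h3
    (show Complex.I ∈ ball (0 : ℂ) 2 by simp)
  have h5 : ofRealVec x + Complex.I • ofRealVec y = z := by
    ext j
    simp only [ofRealVec, hxdef, hydef, PiLp.add_apply, PiLp.smul_apply, smul_eq_mul]
    rw [mul_comm, Complex.re_add_im]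
  simpa [h5] using h4

/-- The Lie ball is open and stable under scalars of modulus at most 1, so it contains c z for all c
in a disc of radius s > 1; the identity theorem in c reaches c = 1. -/
theorem eqOn_lieBall_of_eqOn_ball {f A : EuclideanSpace ℂ (Fin n) → EuclideanSpace ℂ (Fin n)}
    (hf : DifferentiableOn ℂ f (lieBall n)) (hA : Differentiable ℂ A) {ε : ℝ} (hε : 0 < ε)
    (h : ∀ z, ‖z‖ < ε → f z = A z) : EqOn f A (lieBall n) := by
  intro z hz
  obtain ⟨s, hs, hsz⟩ : ∃ s : ℝ, 1 < s ∧ (s : ℂ) • z ∈ lieBall n := by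
    have hc : Continuous fun s : ℝ => (s : ℂ) • z := by fun_prop
    have h1 : ∀ᶠ s : ℝ in 𝓝 1, (s : ℂ) • z ∈ lieBall n :=
      hc.continuousAt.preimage_mem_nhds ((isOpen_lieBall n).mem_nhds (by simpa using hz))
    obtain ⟨s, h2, h3⟩ := ((h1.filter_mono nhdsWithin_le_nhds).and
      (self_mem_nhdsWithin : Ioi (1 : ℝ) ∈ 𝓝[>] 1)).exists
    exact ⟨s, h3, h2⟩
  have hs0 : (s : ℂ) ≠ 0 := by
    have : s ≠ 0 := by linarith
    exact_mod_cast this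
  have hm : ∀ c ∈ ball (0 : ℂ) s, c • z ∈ lieBall n := by
    intro c hc
    rw [mem_ball_zero_iff] at hc
    have h1 := smul_mem_lieBall (c := c / s) (by
      rw [norm_div, Complex.norm_real, Real.norm_of_nonneg (by linarith)]
      exact (div_le_one (by linarith)).2 hc.le) hsz
    rwa [smul_smul, div_mul_cancel₀ _ hs0] at h1
  have h1 := differentiableOn_comp_smul hf hm
  have h2 : DifferentiableOn ℂ (fun c : ℂ => A (c • z)) (ball 0 s) :=
    (hA.comp (by fun_prop : Differentiable ℂ fun c : ℂ => c • z)).differentiableOn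
  have h3 : ∀ᶠ c : ℂ in 𝓝 0, f (c • z) = A (c • z) := by
    have hc : Continuous fun c : ℂ => c • z := by fun_prop
    have h4 : ∀ᶠ c : ℂ in 𝓝 0, c • z ∈ ball 0 ε :=
      hc.continuousAt.preimage_mem_nhds (by simpa using ball_mem_nhds _ hε)
    exact h4.mono fun c hc => h _ (by simpa using hc)
  have h4 := (h1.analyticOnNhd isOpen_ball).eqOn_of_preconnected_of_eventuallyEq
    (h2.analyticOnNhd isOpen_ball) (convex_ball _ _).isPreconnected
    (mem_ball_self (by linarith)) h3 (show (1 : ℂ) ∈ ball (0 : ℂ) s by simpa using hs)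
  simpa using h4

/-- An automorphism of the Lie ball that fixes the origin is linear, and it is liftable. -/
theorem liftable_of_map_zero (hn : 1 ≤ n)
    {f g : EuclideanSpace ℂ (Fin n) → EuclideanSpace ℂ (Fin n)}
    (hf : DifferentiableOn ℂ f (lieBall n)) (hg : DifferentiableOn ℂ g (lieBall n))
    (hfm : MapsTo f (lieBall n) (lieBall n)) (hgm : MapsTo g (lieBall n) (lieBall n))
    (hgf : LeftInvOn g f (lieBall n)) (hfg : LeftInvOn f g (lieBall n)) (hf0 : f 0 = 0) :
    Liftable n f g := by
  have hg0 : g 0 = 0 := by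
    have := hgf (zero_mem_lieBall n)
    rwa [hf0] at this
  have h1 := schwarzBounds_fderiv hf hg hfm hgm hgf hf0 hg0
  have h2 := schwarzBounds_fderiv hg hf hgm hfm hfg hg0 hf0
  refine (liftable_of_schwarzBounds hn h1 h2).congr ?_ ?_
  · exact eqOn_lieBall_of_eqOn_ball hf (fderiv ℂ f 0).differentiable (by norm_num) fun z hz =>
      eq_of_eq_on_real_disc hf (fderiv ℂ f 0).differentiable
        (eq_fderiv_ofRealVec hf hfm hf0 h1.norm_apply) hz
  · exact eqOn_lieBall_of_eqOn_ball hg (fderiv ℂ g 0).differentiable (by norm_num) fun z hz =>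
      eq_of_eq_on_real_disc hg (fderiv ℂ g 0).differentiable
        (eq_fderiv_ofRealVec hg hgm hg0 h2.norm_apply) hz

theorem liftable_of_automorphism (hn : 1 ≤ n)
    {f g : EuclideanSpace ℂ (Fin n) → EuclideanSpace ℂ (Fin n)}
    (hf : DifferentiableOn ℂ f (lieBall n)) (hg : DifferentiableOn ℂ g (lieBall n))
    (hfm : MapsTo f (lieBall n) (lieBall n)) (hgm : MapsTo g (lieBall n) (lieBall n))
    (hgf : LeftInvOn g f (lieBall n)) (hfg : LeftInvOn f g (lieBall n)) : Liftable n f g := by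
  -- With p(f(0)) = 0, the map p ∘ f fixes the origin, and f is recovered as p' ∘ (p ∘ f).
  obtain ⟨p, p', hp, hp0⟩ := exists_liftable_eq_zero (hfm (zero_mem_lieBall n))
  have h1 : Liftable n (p ∘ f) (g ∘ p') :=
    liftable_of_map_zero hn (hp.differentiableOn.comp hf hfm)
      (hg.comp hp.symm.differentiableOn hp.symm.mapsTo) (hp.mapsTo.comp hfm)
      (hgm.comp hp.symm.mapsTo) (hgf.comp hp.leftInvOn hfm)
      (hp.symm.leftInvOn.comp hfg hp.symm.mapsTo) hp0
  refine (hp.symm.comp h1).congr (fun z hz => ?_) fun z hz => ?_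
  · exact (hp.leftInvOn (hfm hz)).symm
  · simp only [Function.comp_apply]
    rw [hp.leftInvOn hz]

end Cartan

/-! ### Transfer from the locus set to L_n, and the theorem. -/

section LocusSet

variable {n : ℕ}

theorem differentiableOn_dropFirst_comp_consZero
    {h : EuclideanSpace ℂ (Fin (n + 1)) → EuclideanSpace ℂ (Fin (n + 1))}
    (hh : HolomorphicOnSet h (consZero n '' lieBall n)) :
    DifferentiableOn ℂ (dropFirst ∘ h ∘ consZero n) (lieBall n) := by
  intro z hz
  obtain ⟨U, H, hU, hzU, hH, hhH⟩ := hh _ (mem_image_of_mem _ hz)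
  have h1 : DifferentiableAt ℂ (dropFirst ∘ H ∘ consZero n) z :=
    (differentiable_dropFirst n _).comp z
      (((hH _ hzU).differentiableAt (hU.mem_nhds hzU)).comp z (differentiable_consZero n z))
  refine (h1.congr_of_eventuallyEq ?_).differentiableWithinAt
  filter_upwards [(isOpen_lieBall n).mem_nhds hz,
    (differentiable_consZero n).continuous.continuousAt.preimage_mem_nhds (hU.mem_nhds hzU)]
    with w hw hwU
  simp only [Function.comp_apply]
  rw [hhH ⟨mem_image_of_mem _ hw, hwU⟩]

theorem consZero_dropFirst_of_mapsTo
    {h : EuclideanSpace ℂ (Fin (n + 1)) → EuclideanSpace ℂ (Fin (n + 1))}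
    (hm : MapsTo h (consZero n '' lieBall n) (consZero n '' lieBall n))
    {z : EuclideanSpace ℂ (Fin n)} (hz : z ∈ lieBall n) :
    dropFirst (h (consZero n z)) ∈ lieBall n ∧
      consZero n (dropFirst (h (consZero n z))) = h (consZero n z) := by
  obtain ⟨w, hw, hwz⟩ := hm (mem_image_of_mem _ hz)
  rw [← hwz, dropFirst_consZero]
  exact ⟨hw, rfl⟩

theorem exists_liftable_of_isHolAut (hn : 1 ≤ n)
    {h : EuclideanSpace ℂ (Fin (n + 1)) → EuclideanSpace ℂ (Fin (n + 1))}
    (hh : IsHolAut h (consZero n '' lieBall n)) :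
    ∃ f f', Liftable n f f' ∧ ∀ z ∈ lieBall n, consZero n (f z) = h (consZero n z) := by
  obtain ⟨hm, hhol, k, km, khol, hkh, hhk⟩ := hh
  refine ⟨dropFirst ∘ h ∘ consZero n, dropFirst ∘ k ∘ consZero n,
    liftable_of_automorphism hn (differentiableOn_dropFirst_comp_consZero hhol)
      (differentiableOn_dropFirst_comp_consZero khol)
      (fun z hz => (consZero_dropFirst_of_mapsTo hm hz).1)
      (fun z hz => (consZero_dropFirst_of_mapsTo km hz).1) (fun z hz => ?_) fun z hz => ?_,
    fun z hz => (consZero_dropFirst_of_mapsTo hm hz).2⟩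
  · simp only [Function.comp_apply]
    rw [(consZero_dropFirst_of_mapsTo hm hz).2, hkh (mem_image_of_mem _ hz), dropFirst_consZero]
  · simp only [Function.comp_apply]
    rw [(consZero_dropFirst_of_mapsTo km hz).2, hhk (mem_image_of_mem _ hz), dropFirst_consZero]

end LocusSet

theorem mainTheorem8 (n : ℕ) (hn : 1 ≤ n) :
    -- the locus set is `{0} × L_n`, and it is mapped by `Λ_{n+1}` onto itself
    locusSet (squareFirst n) (lieBall (n + 1)) = consZero n '' lieBall n ∧
    squareFirst n '' locusSet (squareFirst n) (lieBall (n + 1)) =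
      locusSet (squareFirst n) (lieBall (n + 1)) ∧
    locusSet (squareFirst n) (lieBall (n + 1)) ⊆ lieBallImage n ∧
    -- every automorphism of the locus set extends to `𝕃_{n+1}`, through an extension to `L_{n+1}`
    ∀ h : EuclideanSpace ℂ (Fin (n + 1)) → EuclideanSpace ℂ (Fin (n + 1)),
      IsHolAut h (locusSet (squareFirst n) (lieBall (n + 1))) →
      ∃ F a : EuclideanSpace ℂ (Fin (n + 1)) → EuclideanSpace ℂ (Fin (n + 1)),
        IsHolAut F (lieBallImage n) ∧
        Set.EqOn F h (locusSet (squareFirst n) (lieBall (n + 1))) ∧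
        IsHolAut a (lieBall (n + 1)) ∧
        Set.EqOn a h (locusSet (squareFirst n) (lieBall (n + 1))) ∧
        PreservesFibers a (squareFirst n) (lieBall (n + 1)) ∧
        ∀ z ∈ lieBall (n + 1), F (squareFirst n z) = squareFirst n (a z) := by
  rw [locusSet_squareFirst]
  have himage : squareFirst n '' (consZero n '' lieBall n) = consZero n '' lieBall n := by
    rw [image_image]
    exact image_congr fun z _ => squareFirst_consZero z
  refine ⟨rfl, himage, ?_, fun h hh => ?_⟩
  · rw [← himage]
    refine image_mono ?_
    rintro _ ⟨z, hz, rfl⟩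
    exact consZero_mem_lieBall.2 hz
  · obtain ⟨f, f', hf, hfh⟩ := exists_liftable_of_isHolAut hn hh
    obtain ⟨F, a, h1, h2, h3, h4, h5, h6⟩ := hf.exists_automorphisms
    refine ⟨F, a, h1, ?_, h2, ?_, h5, h6⟩
    · rintro _ ⟨z, hz, rfl⟩
      rw [h3 z hz, hfh z hz]
    · rintro _ ⟨z, hz, rfl⟩
      rw [h4 z hz, hfh z hz]
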